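/- Let $0\le r\le n$, $[n]=\{1,\dots,n\}$, and let $A=\{a_1<\dots<a_r\}\subseteq[n]$. A set partition of $[n]$ is noncrossing if there are no $p<q<s<t$ with $p,s$ in one block and $q,t$ in another. To such a partition associate the permutation $\prod_B(b_s\,b_{s-1}\cdots b_1)$, the product over its blocks $B=\{b_1<\dots<b_s\}$. Let $\mathrm{NC}_n\subseteq S_n$ be the set of these permutations, with the Kreweras order (refinement of partitions), and let $\mathrm{NC}_n^A=\{w\in \mathrm{NC}_n : w([r])=A\}$. Write $[r]\setminus A=\{\alpha_k<\dots<\alpha_1\}$, $A\setminus[r]=\{\beta_1<\dots<\beta_k\}$, $\beta_0=r$, and set $$z_A=\prod_{p=1}^k(\beta_p\ \ \beta_p-1\ \cdots\ \beta_{p-1}+1\ \ \alpha_p).$$ For $w\in \mathrm{NC}_n$ let $\mathrm{Inv}_{\mathrm{NC}}(w)$ be the set of pairs $(i,j)$ with $i<j$, $w^{-1}(i)>w^{-1}(j)$ and $(i\,j)w\in \mathrm{NC}_n$. Let $\mathrm{Inv}(A)=\{(i,j): i<j,\ j\in A,\ i\notin A\}$, and let $\mathrm{Inv}_Q(A)$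 be the set of $(i,j)\in\mathrm{Inv}(A)$ for which there are $w,u'\in \mathrm{NC}_n$, adjacent in the Hasse diagram of the Kreweras order, with $w([r])=A$ and $u'([r])=(A\setminus\{j\})\cup\{i\}$. In the Grassmannian $\mathrm{Gr}(r;n)$ of $r$-dimensional subspaces of $\mathbb C^n$, let $\mathring X^A$ (respectively $\mathring X^A_{\mathrm{NC}}$) be the set of column spans of $n\times r$ matrices with $1$ in the positions $(a_j,j)$, arbitrary entries in the positions $(i,j)$ with $(i,a_j)\in\mathrm{Inv}(A)$ (respectively $\mathrm{Inv}_Q(A)$), and $0$ elsewhere. In the variety $\mathrm{Fl}_n=\mathrm{GL}_n(\mathbb C)/B$ of complete flags in $\mathbb C^n$ (where $B$ is the group of upper triangular matrices, and $V_i$ is the span of the first $i$ columns), for $w\in \mathrm{NC}_n$ let $\mathring X^w_{\mathrm{NC}}$ be the set of flags represented by $n\times n$ matrices with $1$ in the positions $(w(j),j)$, arbitrary entries in the positions $(i,w^{-1}(j))$ with $(i,j)\in\mathrm{Inv}_{\mathrm{NC}}(w)$, and $0$ elsewhere. Let $\pi:\mathrm{Fl}_n\to\mathrm{Gr}(r;n)$,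 $V_\bullet\mapsto V_r$. Theorem. If $u\in \mathrm{NC}_n^A$, then $\pi(\mathring X^u_{\mathrm{NC}})\subseteq\mathring X^A$. Moreover: 1. if $u=z_A$, then $\pi|_{\mathring X^u_{\mathrm{NC}}}$ is an isomorphism of varieties onto $\mathring X^A_{\mathrm{NC}}$; 2. if $u\ne z_A$, then every nonempty fiber of $\pi|_{\mathring X^u_{\mathrm{NC}}}$ has positive dimension. -/

import Mathlib

/-! ### Combinatorics

The set `{1, …, n}` is modelled by `Fin n = {0, …, n - 1}` with its order (a shift by one). -/

namespace QGr

/-- The backwards cycle `(b_s b_{s-1} … b_1)` of a block `{b_1 < ⋯ < b_s}`. -/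
def backCycle {n : ℕ} (B : Finset (Fin n)) : Equiv.Perm (Fin n) :=
  (B.sort (· ≥ ·)).formPerm

/-- A set partition is noncrossing if no `a < b < c < d` has `a, c` in one block and
`b, d` in another block. -/
def IsNoncrossing {n : ℕ} (P : Finpartition (Finset.univ : Finset (Fin n))) : Prop :=
  ∀ B ∈ P.parts, ∀ C ∈ P.parts, B ≠ C → ∀ a b c d : Fin n, a < b → b < c → c < d →
    ¬ (a ∈ B ∧ c ∈ B ∧ b ∈ C ∧ d ∈ C)

/-- Noncrossing set partitions of `Fin n`, ordered by refinement (the order of `Finpartition`). -/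
abbrev NCPartition (n : ℕ) : Type :=
  {P : Finpartition (Finset.univ : Finset (Fin n)) // IsNoncrossing P}

theorem backCycle_commute {n : ℕ} {B C : Finset (Fin n)} (h : Disjoint B C) :
    Commute (backCycle B) (backCycle C) := by
  apply Equiv.Perm.Disjoint.commute
  intro x
  by_cases hB : x ∈ B
  · right
    refine List.formPerm_apply_of_notMem ?_
    rw [Finset.mem_sort]
    exact Finset.disjoint_left.mp h hB
  · left
    refine List.formPerm_apply_of_notMem ?_
    rwa [Finset.mem_sort]

/-- The algebraic noncrossing partition of a noncrossing set partition: the product of the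
(disjoint, hence commuting) backwards cycles of the blocks. -/
def NCPartition.toPerm {n : ℕ} (P : NCPartition n) : Equiv.Perm (Fin n) :=
  P.1.parts.noncommProd backCycle
    (fun _ hB _ hC hBC => backCycle_commute (P.1.disjoint hB hC hBC))

/-- The set `NC_n` of algebraic noncrossing partitions. -/
def NC (n : ℕ) : Set (Equiv.Perm (Fin n)) := Set.range NCPartition.toPerm

/-- Adjacency in the Hasse diagram of the Kreweras order on `NC_n`, the order induced by
refinement of noncrossing set partitions. -/
def KrewerasAdj {n : ℕ} (w u : Equiv.Perm (Fin n)) : Prop :=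
  ∃ P Q : NCPartition n, P.toPerm = w ∧ Q.toPerm = u ∧ (P ⋖ Q ∨ Q ⋖ P)

/-- The subset `[r]`, the `r` smallest elements. -/
def initial (n r : ℕ) : Finset (Fin n) := Finset.univ.filter (fun i => i.val < r)

/-- `w · [r]`. -/
def act {n : ℕ} (r : ℕ) (w : Equiv.Perm (Fin n)) : Finset (Fin n) := (initial n r).image w

/-- The fiber `NC_n^A = {w ∈ NC_n | w · [r] = A}`. -/
def NCFiber {n : ℕ} (r : ℕ) (A : Finset (Fin n)) : Set (Equiv.Perm (Fin n)) :=
  {w | w ∈ NC n ∧ act r w = A}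

/-- Adjacency in the Johnson graph: `B = (A \ j) ∪ i` with `j ∈ A` and `i ∉ A`. -/
def JAdj {n : ℕ} (A B : Finset (Fin n)) : Prop :=
  ∃ i j : Fin n, i ∉ A ∧ j ∈ A ∧ B = insert i (A.erase j)

/-- Adjacency in the quasisymmetric Johnson graph `QJ_{r,n}`. -/
def QJAdj {n : ℕ} (r : ℕ) (A B : Finset (Fin n)) : Prop :=
  JAdj A B ∧ ∃ w u : Equiv.Perm (Fin n), KrewerasAdj w u ∧ A = act r w ∧ B = act r u

/-- Inversion set of a permutation: pairs `i < j` with `w⁻¹(i) > w⁻¹(j)`. -/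
def invPerm {n : ℕ} (w : Equiv.Perm (Fin n)) : Set (Fin n × Fin n) :=
  {p | p.1 < p.2 ∧ w.symm p.2 < w.symm p.1}

/-- Noncrossing inversions of `w`: inversions `(i, j)` of `w` with `(i j) w ∈ NC_n`. -/
def invNC {n : ℕ} (w : Equiv.Perm (Fin n)) : Set (Fin n × Fin n) :=
  {p | p ∈ invPerm w ∧ Equiv.swap p.1 p.2 * w ∈ NC n}

/-- Inversion set of a subset `A`: pairs `i < j` with `j ∈ A` and `i ∉ A`. -/
def invSet {n : ℕ} (A : Finset (Fin n)) : Set (Fin n × Fin n) :=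
  {p | p.1 < p.2 ∧ p.2 ∈ A ∧ p.1 ∉ A}

/-- Quasisymmetric inversions of `A`: inversions `(i, j)` of `A` such that `A` and
`(A \ j) ∪ i` are adjacent in `QJ_{r,n}`. -/
def invQ {n : ℕ} (r : ℕ) (A : Finset (Fin n)) : Set (Fin n × Fin n) :=
  {p | p ∈ invSet A ∧ QJAdj r A (insert p.1 (A.erase p.2))}

/-- `L = [r] \ A = {a_k < ⋯ < a_1}`. -/
def leftPart {n : ℕ} (r : ℕ) (A : Finset (Fin n)) : Finset (Fin n) := initial n r \ A

/-- `R = A \ [r] = {b_1 < ⋯ < b_k}`. -/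
def rightPart {n : ℕ} (r : ℕ) (A : Finset (Fin n)) : Finset (Fin n) := A \ initial n r

/-- For `b = b_p ∈ R`, the set `{a_p} ∪ {b_{p-1} + 1, …, b_p - 1, b_p}`, where `b_0 = r` in
one-based numbering (so that for `p = 1` the interval consists of all elements outside `[r]` that
are at most `b_1`).
The element `a_p` is the one in `L` with exactly as many elements of `L` above or equal to it
as there are elements of `R` below or equal to `b_p`, namely `p`. -/
def zBlock {n : ℕ} (r : ℕ) (A : Finset (Fin n)) (b : Fin n) : Finset (Fin n) :=
  (leftPart r A).filter (fun a =>
      ((leftPart r A).filter (a ≤ ·)).card = ((rightPart r A).filter (· ≤ b)).card) ∪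
    Finset.univ.filter (fun x =>
      x ∉ initial n r ∧ x ≤ b ∧ ∀ b' ∈ rightPart r A, b' < b → b' < x)

/-- The quasigrassmannian permutation
`z_A = ∏_{p=1}^k (b_p (b_p - 1) … (b_{p-1} + 1) a_p)`. Since `a_p` is smaller than every element
of the interval, each factor is the backwards cycle of its support. -/
def zPerm {n : ℕ} (r : ℕ) (A : Finset (Fin n)) : Equiv.Perm (Fin n) :=
  (((rightPart r A).sort (· ≤ ·)).map (fun b => backCycle (zBlock r A b))).prod

/-! ### The flag variety and the Grassmannian -/

/-- The complete flag variety: flags `0 = V_0 ⊂ V_1 ⊂ ⋯ ⊂ V_n = ℂⁿ` with `dim V_i = i`. -/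
@[ext]
structure FlagVariety (n : ℕ) where
  space : Fin (n + 1) → Submodule ℂ (Fin n → ℂ)
  finrank_space : ∀ i, Module.finrank ℂ (space i) = i.val
  mono : Monotone space

/-- The Grassmannian of `r`-dimensional subspaces of `ℂⁿ`. -/
abbrev Gr (r n : ℕ) : Type :=
  {V : Submodule ℂ (Fin n → ℂ) // Module.finrank ℂ V = r}

/-- The projection sending a flag `V_•` to `V_r`. -/
def proj {n r : ℕ} (hr : r ≤ n) (F : FlagVariety n) : Gr r n :=
  ⟨F.space ⟨r, Nat.lt_succ_of_le hr⟩, F.finrank_space _⟩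

/-- The matrix `M` represents the flag `F`: `V_i` is the span of the first `i` columns. Such
matrices are exactly the elements of one coset in `GL_n / B`. -/
def RepFlag {n : ℕ} (M : Matrix (Fin n) (Fin n) ℂ) (F : FlagVariety n) : Prop :=
  ∀ i : Fin (n + 1), F.space i = Submodule.span ℂ (M.col '' {j | j.val < i.val})

/-- The matrix `M` represents the subspace `V`: its columns span `V`. Such matrices are exactly
the elements of one `GL_r`-orbit of `n × r` matrices of rank `r`. -/
def RepGr {r n : ℕ} (M : Matrix (Fin n) (Fin r) ℂ) (V : Gr r n) : Prop :=
  V.1 = Submodule.span ℂ (Set.range M.col)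

/-! ### Algebraic structure of spaces of matrices of full rank modulo column operations -/

/-- Evaluation of a polynomial in the entries of an `n × m` matrix. -/
noncomputable def evalMat {n m : ℕ} (M : Matrix (Fin n) (Fin m) ℂ)
    (p : MvPolynomial (Fin n × Fin m) ℂ) : ℂ :=
  MvPolynomial.eval (fun ij => M ij.1 ij.2) p

/-- Zariski closed sets of a space whose points are represented (through `ρ`) by matrices: those
whose set of representing matrices is cut out by polynomials in the matrix entries. -/
def IsZariskiClosed {n m : ℕ} {X : Type} (ρ : Matrix (Fin n) (Fin m) ℂ → X → Prop)
    (C : Set X) : Prop :=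
  ∃ S : Set (MvPolynomial (Fin n × Fin m) ℂ),
    ∀ M x, ρ M x → (x ∈ C ↔ ∀ p ∈ S, evalMat M p = 0)

/-- The Zariski topology, i.e. the quotient of the Zariski topology on representing matrices. -/
@[reducible] def zariskiTopology {n m : ℕ} {X : Type} (ρ : Matrix (Fin n) (Fin m) ℂ → X → Prop) :
    TopologicalSpace X :=
  TopologicalSpace.ofClosed {C | IsZariskiClosed ρ C}
    ⟨{1}, fun M x _ => by simp [evalMat]⟩
    (by
      intro T hT
      have hT' : ∀ C ∈ T, IsZariskiClosed ρ C := fun C hC => hT hC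
      choose! S hS using hT'
      refine ⟨⋃ C ∈ T, S C, fun M x h => ?_⟩
      simp only [Set.mem_sInter, Set.mem_iUnion, exists_prop, forall_exists_index, and_imp]
      constructor
      · intro hx p C hC hp
        exact (hS C hC M x h).1 (hx C hC) p hp
      · intro hx C hC
        exact (hS C hC M x h).2 (fun p hp => hx p C hC hp))
    (by
      rintro C ⟨S, hS⟩ D ⟨T, hT⟩
      refine ⟨{f | ∃ p ∈ S, ∃ q ∈ T, f = p * q}, fun M x h => ?_⟩
      rw [Set.mem_union, hS M x h, hT M x h]
      constructor
      · rintro (hx | hx) _ ⟨p, hp, q, hq, rfl⟩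
        · have := hx p hp
          simp only [evalMat, map_mul, mul_eq_zero] at this ⊢
          exact Or.inl this
        · have := hx q hq
          simp only [evalMat, map_mul, mul_eq_zero] at this ⊢
          exact Or.inr this
      · intro hx
        by_contra! hcon
        obtain ⟨⟨p, hp, hp0⟩, q, hq, hq0⟩ := hcon
        have := hx (p * q) ⟨p, hp, q, hq, rfl⟩
        simp only [evalMat, map_mul, mul_eq_zero] at this
        exact this.elim hp0 hq0)

/-- The flag variety carries the Zariski topology of `GL_n / B`. -/
instance {n : ℕ} : TopologicalSpace (FlagVariety n) := zariskiTopology RepFlag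

/-- `φ` restricts to a morphism of varieties on `Y`: locally on `Y` (in the Zariski topology) it
is given by a matrix of polynomials in the entries of a representing matrix. Here the source and
the target are spaces of matrices of full rank modulo invertible column operations; the formula
`P` is required to hold at all representatives `M'` of points of `Y` in the Zariski open set where
`P` has full column rank, and each representative `M` of a point of `Y` has to lie in such an open
set. (Denominators may be cleared, since scaling a matrix does not change the point.) -/
def IsRegularOn {n m n' m' : ℕ} {X X' : Type} (ρ : Matrix (Fin n) (Fin m) ℂ → X → Prop)
    (ρ' : Matrix (Fin n') (Fin m') ℂ → X' → Prop) (φ : X → X') (Y : Set X) : Prop :=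
  ∀ M x, x ∈ Y → ρ M x →
    ∃ P : Matrix (Fin n') (Fin m') (MvPolynomial (Fin n × Fin m) ℂ),
      (P.map (evalMat M)).rank = m' ∧
      ∀ M' x', x' ∈ Y → ρ M' x' → (P.map (evalMat M')).rank = m' →
        ρ' (P.map (evalMat M')) (φ x')

/-- `φ` restricts to an isomorphism of varieties from `Y` onto `Z`. -/
def IsIsoOnto {n m n' m' : ℕ} {X X' : Type} (ρ : Matrix (Fin n) (Fin m) ℂ → X → Prop)
    (ρ' : Matrix (Fin n') (Fin m') ℂ → X' → Prop) (φ : X → X') (Y : Set X) (Z : Set X') : Prop :=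
  IsRegularOn ρ ρ' φ Y ∧ Set.MapsTo φ Y Z ∧
    ∃ ψ : X' → X, IsRegularOn ρ' ρ ψ Z ∧ Set.MapsTo ψ Z Y ∧ Set.InvOn ψ φ Y Z

/-! ### Cells -/

/-- Points of the Grassmannian represented by matrices with `1` in the positions `(a_j, j)`,
where `A = {a_1 < ⋯ < a_r}`, arbitrary entries in the positions `(i, j)` with `(i, a_j) ∈ S`, and
`0` elsewhere. -/
def grCell {n r : ℕ} (A : Finset (Fin n)) (hA : A.card = r) (S : Set (Fin n × Fin n)) :
    Set (Gr r n) :=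
  {V | ∃ M : Matrix (Fin n) (Fin r) ℂ,
    (∀ j, M (A.orderEmbOfFin hA j) j = 1) ∧
    (∀ i j, i ≠ A.orderEmbOfFin hA j → (i, A.orderEmbOfFin hA j) ∉ S → M i j = 0) ∧
    RepGr M V}

/-- The Schubert cell of `A` in the Grassmannian. -/
def schubertCell {n r : ℕ} (A : Finset (Fin n)) (hA : A.card = r) : Set (Gr r n) :=
  grCell A hA (invSet A)

/-- The quasisymmetric Schubert cell of `A`: entries at positions of inversions that are not
quasisymmetric are set to zero as well. -/
def quasiSchubertCell {n r : ℕ} (A : Finset (Fin n)) (hA : A.card = r) : Set (Gr r n) :=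
  grCell A hA (invQ r A)

/-- The noncrossing Schubert cell of `w` in the flag variety: flags represented by matrices with
`1` in the positions `(w(j), j)`, arbitrary entries in the positions `(i, w⁻¹(j))` for
`(i, j) ∈ invNC w`, and `0` elsewhere. -/
def ncSchubertCell {n : ℕ} (w : Equiv.Perm (Fin n)) : Set (FlagVariety n) :=
  {F | ∃ M : Matrix (Fin n) (Fin n) ℂ,
    (∀ j, M (w j) j = 1) ∧
    (∀ i j, i ≠ w j → (i, w j) ∉ invNC w → M i j = 0) ∧
    RepFlag M F}

end QGr

/-! ### Backward cycles and labelled noncrossing permutations -/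

namespace QGr

open Equiv

/-! An element `w` of `NC n` is handled through a labelling of points by blocks (`IsBack`,
`Noncross`): `w` steps down inside each block and sends its minimum to its maximum. Multiplying by
`swap i j` cuts a block or joins two. Hence a noncrossing inversion `(i, j)` of `w` is of one of two
kinds (`inv_dichotomy`): `i` and `j` share a block, or `j` is the maximum of a block lying under an
arc `w y = i` that no other arc separates from it.

Let `w` send `[r]` to `A`. Every block meeting `[r] \ A` or `A \ [r]` has exactly one point in each,
and noncrossing makes this matching order-reversing. So the matching depends on `A` alone; it is the
one used to define `z_A`. Two facts follow. A noncrossing inversion `(i, j)` of `w` with `j ∈ A` and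
`i ∉ A` is also one of `z_A`, and coverings in the Kreweras order are transpositions; together these
give `invNC_zPerm_eq_invQ`. Moreover `z_A` is the only element of the fibre all of whose noncrossing
inversions are of this form (`eq_zPerm_of_invNC_subset`).

In the cell of `z_A`, therefore, the rows `A` of the first `r` columns form an identity matrix and
the later columns are unit vectors. The flag is recovered from `V_r` by polynomial formulas up to
scaling columns (`isIsoOnto_of_invNC_subset`). For any other `u` some noncrossing inversion pairs
two columns on the same side of the cut at `r`. Adding multiples of one to the other moves the flag
along a line in the cell while fixing `V_r` (`topologicalKrullDim_fiber_pos`). The inclusion in the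
Schubert cell is column reduction. -/

theorem backCycle_mem {n : ℕ} {B : Finset (Fin n)} {x : Fin n} (hx : x ∈ B) :
    backCycle B x ∈ B := by
  have := List.formPerm_apply_mem_of_mem (l := B.sort (· ≥ ·)) (x := x) ((Finset.mem_sort _).2 hx)
  exact (Finset.mem_sort _).1 this

theorem backCycle_of_notMem {n : ℕ} {B : Finset (Fin n)} {x : Fin n} (hx : x ∉ B) :
    backCycle B x = x :=
  List.formPerm_apply_of_notMem (by rwa [Finset.mem_sort])

/-- The block is listed in decreasing order, so the cycle moves each entry to the next smaller one.
The second alternative is the wrap-around from minimum to maximum, and it includes singletons. -/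
theorem backCycle_step {n : ℕ} {B : Finset (Fin n)} {x : Fin n} (hx : x ∈ B) :
    (backCycle B x < x ∧ ∀ t ∈ B, t < x → t ≤ backCycle B x) ∨
      ∀ t ∈ B, x ≤ t ∧ t ≤ backCycle B x := by
  have hnd : (B.sort (· ≥ ·)).Nodup := Finset.sort_nodup _ _
  have hs : (B.sort (· ≥ ·)).SortedGT := Finset.sortedGT_sort B
  have hget : ∀ t ∈ B, ∃ (k : ℕ) (hk : k < (B.sort (· ≥ ·)).length),
      (B.sort (· ≥ ·))[k] = t := fun t ht =>
    List.getElem_of_mem ((Finset.mem_sort (· ≥ ·)).2 ht)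
  have hlt : ∀ (k l : ℕ) (hk : k < (B.sort (· ≥ ·)).length) (hl : l < (B.sort (· ≥ ·)).length),
      (B.sort (· ≥ ·))[k] < (B.sort (· ≥ ·))[l] ↔ l < k := by
    intro k l hk hl
    exact hs.getElem_lt_getElem_iff
  obtain ⟨i, hi, rfl⟩ := hget x hx
  unfold backCycle
  rw [List.formPerm_apply_getElem _ hnd]
  by_cases h : i + 1 < (B.sort (· ≥ ·)).length
  · left
    simp only [Nat.mod_eq_of_lt h]
    refine ⟨(hlt _ _ _ _).2 (Nat.lt_succ_self i), fun t ht htx => ?_⟩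
    obtain ⟨k, hk, rfl⟩ := hget t ht
    rw [hlt] at htx
    rw [← not_lt, hlt]
    omega
  · right
    have h' : i + 1 = (B.sort (· ≥ ·)).length := by omega
    simp only [h', Nat.mod_self]
    intro t ht
    obtain ⟨k, hk, rfl⟩ := hget t ht
    constructor
    · rw [← not_lt, hlt]; omega
    · rw [← not_lt, hlt]; omega

/-- `w` acts on every fibre of the labelling `c` as the backwards cycle of that fibre. -/
structure IsBack {n : ℕ} {α : Type*} (w : Perm (Fin n)) (c : Fin n → α) : Prop where
  label : ∀ x, c (w x) = c x
  step : ∀ x, (w x < x ∧ ∀ t, c t = c x → t < x → t ≤ w x) ∨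
    ∀ t, c t = c x → x ≤ t ∧ t ≤ w x

/-- The fibres of `c` form a noncrossing partition. -/
def Noncross {n : ℕ} {α : Type*} (c : Fin n → α) : Prop :=
  ∀ p q s t, p < q → q < s → s < t → c p = c s → c q = c t → c p = c q

namespace IsBack

variable {n : ℕ} {α β : Type*} {w w' : Perm (Fin n)} {c : Fin n → α} {c' : Fin n → β}

theorem congr_label (h : IsBack w c) (hc : ∀ x y, c x = c y ↔ c' x = c' y) : IsBack w c' where
  label x := (hc _ _).1 (h.label x)
  step x := by
    simpa only [← hc] using h.step x

/-- The image of `x` is forced to be its predecessor in the block or, at the minimum, the maximum.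
Permutations can thus be compared through labels alone. -/
theorem ext (h : IsBack w c) (h' : IsBack w' c) : w = w' := by
  ext1 x
  have l1 := h.label x
  have l2 := h'.label x
  rcases h.step x with ⟨a1, a2⟩ | a <;> rcases h'.step x with ⟨b1, b2⟩ | b
  · exact le_antisymm (b2 _ l1 a1) (a2 _ l2 b1)
  · exact absurd (b _ l1).1 (not_le.2 a1)
  · exact absurd (a _ l2).1 (not_le.2 b1)
  · exact le_antisymm (b _ l1).2 (a _ l2).2

end IsBack

theorem Noncross.congr_label {n : ℕ} {α β : Type*} {c : Fin n → α} {c' : Fin n → β}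
    (h : Noncross c) (hc : ∀ x y, c x = c y ↔ c' x = c' y) : Noncross c' := by
  intro p q s t h1 h2 h3 h4 h5
  exact (hc _ _).1 (h p q s t h1 h2 h3 ((hc _ _).2 h4) ((hc _ _).2 h5))

theorem part_eq_part_iff {n : ℕ} (P : Finpartition (Finset.univ : Finset (Fin n)))
    (x y : Fin n) : P.part x = P.part y ↔ x ∈ P.part y :=
  (P.mem_part_iff_part_eq_part (Finset.mem_univ _) (Finset.mem_univ _)).symm

theorem isNoncrossing_iff {n : ℕ} (P : Finpartition (Finset.univ : Finset (Fin n))) :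
    IsNoncrossing P ↔ Noncross P.part := by
  constructor
  · intro h p q s t h1 h2 h3 h4 h5
    by_contra hne
    refine h (P.part p) (by simp) (P.part q) (by simp) hne p q s t h1 h2 h3 ⟨by simp, ?_, by simp, ?_⟩
    · rw [h4]; simp
    · rw [h5]; simp
  · rintro h B hB C hC hne p q s t h1 h2 h3 ⟨h4, h5, h6, h7⟩
    apply hne
    have e1 := P.part_eq_of_mem hB h4
    have e2 := P.part_eq_of_mem hB h5
    have e3 := P.part_eq_of_mem hC h6
    have e4 := P.part_eq_of_mem hC h7
    rw [← e1, ← e3]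
    exact h p q s t h1 h2 h3 (e1.trans e2.symm) (e3.trans e4.symm)

theorem NCPartition.toPerm_apply {n : ℕ} (P : NCPartition n) (x : Fin n) :
    P.toPerm x = backCycle (P.1.part x) x := by
  have hx : P.1.part x ∈ P.1.parts := by simp
  have hmul := Finset.mul_noncommProd_erase P.1.parts hx backCycle
    (fun _ hB _ hC hBC => backCycle_commute (P.1.disjoint hB hC hBC))
  refine (congrArg (fun σ : Perm (Fin n) => σ x) hmul).symm.trans ?_
  simp only [Perm.mul_apply]
  congr 1
  -- The cycles of all other blocks fix `x`.
  refine Finset.noncommProd_induction _ _ _ (fun σ : Perm (Fin n) => σ x = x) ?_ rfl ?_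
  · intro σ τ hσ hτ
    rw [Perm.mul_apply, hτ, hσ]
  · intro B hB
    apply backCycle_of_notMem
    intro hxB
    rw [Finset.mem_erase] at hB
    exact hB.1 (P.1.part_eq_of_mem hB.2 hxB).symm

theorem NCPartition.isBack {n : ℕ} (P : NCPartition n) : IsBack P.toPerm P.1.part where
  label x := by
    rw [part_eq_part_iff, P.toPerm_apply]
    exact backCycle_mem (by simp)
  step x := by
    simp only [part_eq_part_iff, P.toPerm_apply]
    exact backCycle_step (by simp)

theorem NCPartition.noncross {n : ℕ} (P : NCPartition n) : Noncross P.1.part :=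
  (isNoncrossing_iff _).1 P.2

theorem NCPartition.le_iff {n : ℕ} {P Q : NCPartition n} :
    P ≤ Q ↔ ∀ x y, P.1.part x = P.1.part y → Q.1.part x = Q.1.part y := by
  constructor
  · intro h x y hxy
    obtain ⟨C, hC, hle⟩ := h (show P.1.part x ∈ P.1.parts by simp)
    have h1 : x ∈ C := hle (by simp)
    have h2 : y ∈ C := hle (by rw [hxy]; simp)
    rw [Q.1.part_eq_of_mem hC h1, Q.1.part_eq_of_mem hC h2]
  · intro h B hB
    obtain ⟨x, hx⟩ := P.1.nonempty_of_mem_parts hB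
    refine ⟨Q.1.part x, by simp, fun y hy => ?_⟩
    rw [← part_eq_part_iff]
    apply h
    rw [P.1.part_eq_of_mem hB hx, P.1.part_eq_of_mem hB hy]

theorem exists_ncPartition {n : ℕ} {α : Type*} {w : Perm (Fin n)} {c : Fin n → α}
    (h : IsBack w c) (hc : Noncross c) :
    ∃ P : NCPartition n, P.toPerm = w ∧ ∀ x y, c x = c y ↔ P.1.part x = P.1.part y := by
  classical
  have key : ∀ x y, c x = c y ↔ (Finpartition.ofSetoid (Setoid.ker c)).part x =
      (Finpartition.ofSetoid (Setoid.ker c)).part y := by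
    intro x y
    rw [part_eq_part_iff, Finpartition.mem_part_ofSetoid_iff_rel, Setoid.ker_def, eq_comm]
  refine ⟨⟨Finpartition.ofSetoid (Setoid.ker c), (isNoncrossing_iff _).2 (hc.congr_label key)⟩,
    ?_, key⟩
  exact (NCPartition.isBack _).ext (h.congr_label key)

theorem mem_NC_of_isBack {n : ℕ} {α : Type*} {w : Perm (Fin n)} {c : Fin n → α}
    (h : IsBack w c) (hc : Noncross c) : w ∈ NC n := by
  obtain ⟨P, hP, -⟩ := exists_ncPartition h hc
  exact ⟨P, hP⟩

theorem exists_label {n : ℕ} {w : Perm (Fin n)} (h : w ∈ NC n) :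
    ∃ c : Fin n → Finset (Fin n), IsBack w c ∧ Noncross c := by
  obtain ⟨P, rfl⟩ := h
  exact ⟨_, P.isBack, P.noncross⟩

end QGr

/-! ### Splitting and merging blocks by transpositions -/

namespace QGr

open Equiv

section Labelled

variable {n : ℕ} {α : Type*} {w : Perm (Fin n)} {c : Fin n → α}

/-- The labelling obtained by cutting the part of the fibre of `i` in `(i, j]` off that fibre. -/
def splitLabel {n : ℕ} {α : Type*} (c : Fin n → α) (i j x : Fin n) : α × Prop :=
  (c x, c x = c i ∧ i < x ∧ x ≤ j)

theorem splitLabel_eq_iff {i j x y : Fin n} : splitLabel c i j x = splitLabel c i j y ↔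
    c x = c y ∧ (c x = c i → ((i < x ∧ x ≤ j) ↔ (i < y ∧ y ≤ j))) := by
  unfold splitLabel
  rw [Prod.mk.injEq, eq_iff_iff]
  grind

theorem swap_mul_apply (w : Perm (Fin n)) (i j x : Fin n) :
    (swap i j * w) x = if w x = i then j else if w x = j then i else w x := by
  rw [Perm.mul_apply, swap_apply_def]

/-- The least block point in `(i, j]` is the one that `w` sends to `i`; it now goes to `j`, closing
a cycle on that part. The preimage of `j` now goes to `i`, skipping the removed points. -/
theorem IsBack.split (h : IsBack w c) {i j : Fin n} (hij : i < j) (hc : c i = c j) :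
    IsBack (swap i j * w) (splitLabel c i j) where
  label x := by
    rw [splitLabel_eq_iff, swap_mul_apply]
    have h1 := h.label x
    have h2 := h.step x
    grind
  step x := by
    simp only [splitLabel_eq_iff, swap_mul_apply]
    have h1 := h.label x
    have h2 := h.step x
    grind

theorem Noncross.split (h : Noncross c) (i j : Fin n) : Noncross (splitLabel c i j) := by
  intro p q s t h1 h2 h3 h4 h5
  rw [splitLabel_eq_iff] at *
  have := h p q s t h1 h2 h3 h4.1 h5.1
  grind

/-- Left multiplication by a transposition joins two orbits or splits one. -/
theorem label_eq_or_of_swap {β : Type*} {u : Perm (Fin n)} {c' : Fin n → β} {i j : Fin n}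
    (hw : ∀ x, c (w x) = c x) (hu : ∀ x, c' (u x) = c' x) (h : u = swap i j * w) :
    c i = c j ∨ c' i = c' j := by
  by_contra! hcon
  obtain ⟨h1, h2⟩ := hcon
  have hlab : ∀ k : ℕ, c ((w ^ k) j) = c j := by
    intro k
    induction k with
    | zero => rfl
    | succ k ih => rw [pow_succ', Perm.mul_apply, hw, ih]
  -- The `w`-orbit of `j` avoids `i`, so each step along it is also a step of `u` unless it returns
  -- to `j`. At that return `u` goes to `i` instead, which gives `c' i = c' j`.
  have key : ∀ k : ℕ, c' ((w ^ k) j) = c' j := by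
    intro k
    induction k with
    | zero => rfl
    | succ k ih =>
      have e := hu ((w ^ k) j)
      rw [h, swap_mul_apply] at e
      have e2 := hlab (k + 1)
      rw [pow_succ', Perm.mul_apply] at e2 ⊢
      split_ifs at e with h3 h4
      · exact absurd (h3 ▸ e2) h1
      · rw [h4]
      · rw [e, ih]
  obtain ⟨k, hk⟩ : ∃ k : ℕ, (w ^ (k + 1)) j = j := by
    refine ⟨orderOf w - 1, ?_⟩
    have : 0 < orderOf w := orderOf_pos w
    rw [Nat.sub_add_cancel this, pow_orderOf_eq_one]; rfl
  have e := hu ((w ^ k) j)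
  rw [pow_succ', Perm.mul_apply] at hk
  have hji : j ≠ i := fun hji => h1 (by rw [hji])
  rw [h, swap_mul_apply, hk, if_neg hji, if_pos rfl, key k] at e
  exact h2 e

/-- If a fibre not containing `j` has elements on both sides of `j`, then an arc of `w` between
elements of that fibre passes over `j`. -/
theorem IsBack.exists_arc (h : IsBack w c) {j p q : Fin n} (hp : p < j) (hq : j < q)
    (hpq : c p = c q) (hj : c j ≠ c p) : ∃ s, j < s ∧ w s < j ∧ p ≤ w s ∧ c s = c p := by
  classical
  -- The first point of the fibre beyond `j`; its predecessor lies before `j`.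
  obtain ⟨s, hs, hmin⟩ := (Finset.univ.filter (fun t => j < t ∧ c t = c p)).exists_min_image id
    ⟨q, by simp [hq, hpq]⟩
  simp only [Finset.mem_filter, Finset.mem_univ, true_and, id] at hs hmin
  have h1 := h.label s
  have h2 := h.step s
  refine ⟨s, ?_⟩
  grind

/-- The labelling obtained by merging the fibres of `i` and `j`. -/
def mergeLabel {n : ℕ} {α : Type*} [DecidableEq α] (c : Fin n → α) (i j x : Fin n) : α :=
  if c x = c j then c i else c x

/-- A block with maximum `j` may be merged into a block that has an arc `w y = i` over `j`,
provided that no other arc separates them. -/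
theorem swap_mul_mem_NC_of_arc (h : IsBack w c) (hc : Noncross c) {i j : Fin n} (hij : i < j)
    (hx : w.symm j ≤ j) (hy : j < w.symm i) (hs : ∀ s, j < s → w s < j → w s ≤ i) :
    swap i j * w ∈ NC n := by
  classical
  obtain ⟨x, rfl⟩ : ∃ x, w x = j := ⟨w.symm j, by simp⟩
  obtain ⟨y, rfl⟩ : ∃ y, w y = i := ⟨w.symm i, by simp⟩
  rw [symm_apply_apply] at hx hy
  have lx := h.label x
  have ly := h.label y
  -- Since `x ≤ w x`, the point `x` is the minimum of its block and `w x`, the former `j`, the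
  -- maximum.
  have sx : ∀ t, c t = c x → x ≤ t ∧ t ≤ w x := by
    have := h.step x
    grind
  have sy : ∀ t, c t = c y → t < y → t ≤ w y := by
    have := h.step y
    grind
  have hne : c x ≠ c y := by grind
  -- The block of `x` lies strictly under the arc from `y` to `w y`, so merging inserts it between
  -- two consecutive points of the block of `y`.
  have hlt : w y < x := by
    have := hc x (w y) (w x) y
    grind
  have hmerge : ∀ s t, mergeLabel c (w y) (w x) s = mergeLabel c (w y) (w x) t ↔
      c s = c t ∨ (c s = c x ∧ c t = c y) ∨ (c s = c y ∧ c t = c x) := by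
    intro s t
    unfold mergeLabel
    rw [lx, ly]
    grind
  refine mem_NC_of_isBack (c := mergeLabel c (w y) (w x)) ⟨fun t => ?_, fun t => ?_⟩ ?_
  · rw [hmerge, swap_mul_apply]
    have := h.label t
    have := w.injective.eq_iff (a := t) (b := x)
    have := w.injective.eq_iff (a := t) (b := y)
    grind
  · simp only [hmerge, swap_mul_apply]
    have := h.label t
    have := h.step t
    have := w.injective.eq_iff (a := t) (b := x)
    have := w.injective.eq_iff (a := t) (b := y)
    by_cases htx : t = x
    · subst htx
      grind
    by_cases hty : t = y
    · subst hty
      grind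
    rw [if_neg (by grind), if_neg (by grind)]
    by_cases hcx : c t = c x
    · grind
    by_cases hcy : c t = c y
    · have := sy t
      grind
    · grind
  · intro p q s t h1 h2 h3 h4 h5
    rw [hmerge] at *
    -- Any other block with points on both sides of `w x` has an arc over it, whose left end is
    -- bounded by `hs`.
    have hF : ∀ p t, p < w x → w x < t → c p = c t → c p ≠ c x → p ≤ w y := by
      intro p t h1 h2 h3 h4
      obtain ⟨a, ha⟩ := h.exists_arc h1 h2 h3 (by rw [lx]; exact h4.symm)
      exact ha.2.2.1.trans (hs a ha.1 ha.2.1)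
    have hB : ∀ t, c t = c y → t ≤ w y ∨ y ≤ t := fun t ht => by
      have := sy t ht
      grind
    by_contra hcon
    rcases h4 with h4 | ⟨hp, hs'⟩ | ⟨hp, hs'⟩ <;> rcases h5 with h5 | ⟨hq, ht⟩ | ⟨hq, ht⟩
    · exact hcon (Or.inl (hc p q s t h1 h2 h3 h4 h5))
    · have e1 := hc p q s (w x) h1 h2
      have e2 := hc p (w y) s y
      have e3 := hc p y s t
      have e4 := hF p s
      have e5 := sx q hq
      have e6 := hB t ht
      grind
    · have e1 := hc p q s (w y) h1 h2
      have e2 := hc p (w y) s y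
      have e5 := sx t ht
      have e6 := hB q hq
      grind
    · have e1 := hc p q (w x) t h1
      have e2 := hc (w y) q y t
      have e3 := hc y q s t
      have e5 := sx p hp
      have e6 := hB s hs'
      grind
    · grind
    · grind
    · have e1 := hc p q (w y) t h1
      have e2 := hF q t
      have e3 := hc q s t (w x)
      have e5 := sx s hs'
      have e6 := hB p hp
      grind
    · grind
    · grind

/-- No arc separates the two blocks merged by a noncrossing inversion. -/
theorem arc_le_of_inv {β : Type*} {c' : Fin n → β} {i j : Fin n}
    (h' : IsBack (swap i j * w) c') (hc' : Noncross c') (hcij : c' i = c' j)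
    {s : Fin n} (hs : j < s) (hsj : w s < j) : w s ≤ i := by
  by_contra! hlt
  have l := h'.label s
  have st := h'.step s
  rw [swap_mul_apply, if_neg hlt.ne', if_neg hsj.ne] at l st
  have := hc' i (w s) j s
  grind

/-- The structure of noncrossing inversions: either `i` and `j` lie in one block with maximum `j`,
or the block with maximum `j` lies below an arc from above `j` to `i`. -/
theorem inv_dichotomy {β : Type*} {c' : Fin n → β} {i j : Fin n} (h : IsBack w c)
    (h' : IsBack (swap i j * w) c') (hij : i < j) (hinv : w.symm j < w.symm i) :
    w.symm j ≤ j ∧ i < w.symm i ∧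
      ((c i = c j) ∨ (c' i = c' j ∧ i < w.symm j ∧ j < w.symm i)) := by
  obtain ⟨x, rfl⟩ : ∃ x, w x = j := ⟨w.symm j, by simp⟩
  obtain ⟨y, rfl⟩ : ∃ y, w y = i := ⟨w.symm i, by simp⟩
  rw [symm_apply_apply, symm_apply_apply] at *
  have hor := label_eq_or_of_swap h.label h'.label rfl
  have lx := h.label x
  have ly := h.label y
  have sx := h.step x
  have sy := h.step y
  have lx' := h'.label x
  have ly' := h'.label y
  have sx' := h'.step x
  have sy' := h'.step y
  rw [swap_mul_apply] at lx' ly' sx' sy'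
  have hyx : w x ≠ w y := hij.ne'
  rw [if_neg hyx, if_pos rfl] at lx' sx'
  rw [if_pos rfl] at ly' sy'
  rcases hor with hor | hor
  · grind
  · grind

end Labelled

end QGr

/-! ### Coverings in the Kreweras order and noncrossing inversions -/

namespace QGr

open Equiv

/-- A partition strictly above `P` and below `Q` identifies two points that `P` separates. These lie
in the two halves of the cut block, so the halves are joined and `Q` is reached. -/
theorem NCPartition.covBy_of_split {n : ℕ} {P Q : NCPartition n} {i j : Fin n} (hij : i < j)
    (hc : Q.1.part i = Q.1.part j)
    (hP : ∀ x y, splitLabel Q.1.part i j x = splitLabel Q.1.part i j y ↔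
      P.1.part x = P.1.part y) : P ⋖ Q := by
  have hle : P ≤ Q := NCPartition.le_iff.2 fun x y hxy =>
    (splitLabel_eq_iff.1 ((hP x y).2 hxy)).1
  refine ⟨lt_of_le_not_ge hle fun hge => ?_, fun R hPR hRQ => ?_⟩
  · have := (hP i j).2 (NCPartition.le_iff.1 hge _ _ hc)
    rw [splitLabel_eq_iff] at this
    grind
  · have h1 := NCPartition.le_iff.1 hPR.le
    have h2 := NCPartition.le_iff.1 hRQ.le
    obtain ⟨x, y, hxy, hne⟩ : ∃ x y, R.1.part x = R.1.part y ∧ P.1.part x ≠ P.1.part y := by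
      by_contra! hcon
      exact hPR.not_ge (NCPartition.le_iff.2 hcon)
    apply hRQ.not_ge
    rw [NCPartition.le_iff]
    intro a b hab
    have h3 := h2 _ _ hxy
    rw [Ne, ← hP] at hne
    simp only [← hP] at h1
    simp only [splitLabel_eq_iff] at h1 hne
    generalize R.1.part = p at *
    generalize Q.1.part = q at *
    have e1 := h1 a b
    have e2 := h1 a x
    have e3 := h1 a y
    have e4 := h1 b x
    have e5 := h1 b y
    grind

theorem krewerasAdj_of_split {n : ℕ} {α : Type*} {w : Perm (Fin n)} {c : Fin n → α}
    (h : IsBack w c) (hc : Noncross c) {i j : Fin n} (hij : i < j) (hcij : c i = c j) :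
    KrewerasAdj w (swap i j * w) := by
  obtain ⟨Q, hQ, hcQ⟩ := exists_ncPartition h hc
  subst hQ
  obtain ⟨P, hP, hcP⟩ := exists_ncPartition (Q.isBack.split hij ((hcQ _ _).1 hcij))
    (Q.noncross.split i j)
  exact ⟨Q, P, rfl, hP, Or.inr (NCPartition.covBy_of_split hij ((hcQ _ _).1 hcij) hcP)⟩

theorem KrewerasAdj.symm {n : ℕ} {w u : Perm (Fin n)} (h : KrewerasAdj w u) :
    KrewerasAdj u w := by
  obtain ⟨P, Q, hP, hQ, h⟩ := h
  exact ⟨Q, P, hQ, hP, h.symm⟩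

theorem KrewerasAdj.mem_NC {n : ℕ} {w u : Perm (Fin n)} (h : KrewerasAdj w u) : w ∈ NC n := by
  obtain ⟨P, Q, hP, -⟩ := h
  exact ⟨P, hP⟩

/-- Take a block of `Q` that splits in `P`, with minimum `m`. The `P`-block of `m` leaves gaps, and
noncrossing keeps every other `P`-block inside one gap or outside it. Cutting the part of the
`Q`-block in one occupied gap therefore stays above `P`. -/
theorem NCPartition.exists_split_of_lt {n : ℕ} {P Q : NCPartition n} (h : P < Q) :
    ∃ i j, i < j ∧ Q.1.part i = Q.1.part j ∧
      ∀ x y, P.1.part x = P.1.part y → splitLabel Q.1.part i j x = splitLabel Q.1.part i j y := by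
  classical
  have hle := NCPartition.le_iff.1 h.le
  have hnc := P.noncross
  obtain ⟨x, y, hxy, hne⟩ : ∃ x y, Q.1.part x = Q.1.part y ∧ P.1.part x ≠ P.1.part y := by
    by_contra! hcon
    exact h.not_ge (NCPartition.le_iff.2 hcon)
  generalize P.1.part = p at *
  generalize Q.1.part = q at *
  obtain ⟨m, hm, hmin⟩ := (Finset.univ.filter (fun t => q t = q x)).exists_min_image id
    ⟨x, by simp⟩
  simp only [Finset.mem_filter, Finset.mem_univ, true_and, id] at hm hmin
  obtain ⟨t, ht, htm⟩ : ∃ t, q t = q x ∧ p t ≠ p m := by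
    by_cases hx : p x = p m
    · exact ⟨y, hxy.symm, fun hy => hne (hx.trans hy.symm)⟩
    · exact ⟨x, rfl, hx⟩
  have hmt : m < t := lt_of_le_of_ne (hmin t ht) (by grind)
  -- Here `i` is the left end of the gap containing `t`, and `j` below is the last point of the
  -- `Q`-block in that gap.
  obtain ⟨i, hi, himax⟩ := (Finset.univ.filter (fun s => p s = p m ∧ s < t)).exists_max_image id
    ⟨m, by simp [hmt]⟩
  simp only [Finset.mem_filter, Finset.mem_univ, true_and, id] at hi himax
  obtain ⟨j, hj, hjmax⟩ := (Finset.univ.filter (fun s => q s = q x ∧ i < s ∧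
    ∀ b, p b = p m → i < b → s < b)).exists_max_image id
    ⟨t, by
      simp only [Finset.mem_filter, Finset.mem_univ, true_and]
      refine ⟨ht, hi.2, fun b hb hib => ?_⟩
      by_contra hbt
      have : b ≠ t := by grind
      grind⟩
  simp only [Finset.mem_filter, Finset.mem_univ, true_and, id] at hj hjmax
  have hqi : q i = q x := (hle _ _ hi.1).trans hm
  refine ⟨i, j, hj.2.1, hqi.trans hj.1.symm, ?_⟩
  have key : ∀ s s', p s = p s' → q s = q i → (i < s ∧ s ≤ j) → (i < s' ∧ s' ≤ j) := by
    intro s s' hss hs hint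
    have e0 := hle _ _ hss
    have e1 : p s ≠ p m := by grind
    have e2 : i < s' := by
      have := hnc m s' i s
      have := hmin s'
      grind
    refine ⟨e2, ?_⟩
    by_contra! hlt
    have : ¬ ∀ b, p b = p m → i < b → s' < b := fun hall =>
      hlt.not_ge (hjmax s' ⟨by grind, e2, hall⟩)
    push Not at this
    obtain ⟨b, hb1, hb2, hb3⟩ := this
    have := hnc i s b s'
    have := hj.2.2 b
    grind
  intro a b hab
  rw [splitLabel_eq_iff]
  have := hle _ _ hab
  exact ⟨this, fun ha => ⟨key a b hab ha, key b a hab.symm (this ▸ ha)⟩⟩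

/-- Some single cut of `Q` lies weakly above `P` and strictly below `Q`; under a covering it must be
`P`. -/
theorem NCPartition.toPerm_of_covBy {n : ℕ} {P Q : NCPartition n} (h : P ⋖ Q) :
    ∃ i j, i < j ∧ P.toPerm = swap i j * Q.toPerm := by
  obtain ⟨i, j, hij, hc, hle⟩ := NCPartition.exists_split_of_lt h.1
  obtain ⟨R, hR, hcR⟩ := exists_ncPartition (Q.isBack.split hij hc) (Q.noncross.split i j)
  refine ⟨i, j, hij, ?_⟩
  have hPR : P ≤ R := NCPartition.le_iff.2 fun x y hxy => (hcR _ _).1 (hle x y hxy)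
  have hRQ : R < Q := (NCPartition.covBy_of_split hij hc hcR).1
  rcases hPR.eq_or_lt with rfl | hlt
  · exact hR
  · exact absurd hRQ (h.2 hlt)

theorem KrewerasAdj.exists_swap {n : ℕ} {w u : Perm (Fin n)} (h : KrewerasAdj w u) :
    ∃ i j, i < j ∧ u = swap i j * w := by
  obtain ⟨P, Q, rfl, rfl, h | h⟩ := h
  · obtain ⟨i, j, hij, e⟩ := NCPartition.toPerm_of_covBy h
    exact ⟨i, j, hij, by rw [e, ← mul_assoc, swap_mul_self, one_mul]⟩
  · exact NCPartition.toPerm_of_covBy h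

/-! ### Noncrossing inversions -/

section Inversions

variable {n : ℕ} {α : Type*} {w : Perm (Fin n)} {c : Fin n → α}

theorem mem_invNC_of_label_eq (h : IsBack w c) (hc : Noncross c) {i j : Fin n} (hij : i < j)
    (hcij : c i = c j) (hinv : w.symm j < w.symm i) : (i, j) ∈ invNC w :=
  ⟨⟨hij, hinv⟩, mem_NC_of_isBack (h.split hij hcij) (hc.split i j)⟩

theorem mem_invNC_of_arc (h : IsBack w c) (hc : Noncross c) {i j : Fin n} (hij : i < j)
    (hx : w.symm j ≤ j) (hy : j < w.symm i) (hs : ∀ s, j < s → w s < j → w s ≤ i) :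
    (i, j) ∈ invNC w :=
  ⟨⟨hij, hx.trans_lt hy⟩, swap_mul_mem_NC_of_arc h hc hij hx hy hs⟩

theorem invNC_cases (h : IsBack w c) {i j : Fin n} (hij : (i, j) ∈ invNC w) :
    i < j ∧ w.symm j ≤ j ∧ i < w.symm i ∧ (c i = c j ∨
      (i < w.symm j ∧ j < w.symm i ∧ ∀ s, j < s → w s < j → w s ≤ i)) := by
  obtain ⟨⟨h1, h2⟩, h3⟩ := hij
  obtain ⟨c', h', hc'⟩ := exists_label h3
  obtain ⟨a1, a2, a3⟩ := inv_dichotomy h h' h1 h2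
  exact ⟨h1, a1, a2, a3.imp_right fun a => ⟨a.2.1, a.2.2, fun s => arc_le_of_inv h' hc' a.1⟩⟩

theorem krewerasAdj_of_mem_invNC (hw : w ∈ NC n) {i j : Fin n} (hij : (i, j) ∈ invNC w) :
    KrewerasAdj w (swap i j * w) := by
  obtain ⟨c, h, hc⟩ := exists_label hw
  obtain ⟨⟨h1, h2⟩, h3⟩ := hij
  obtain ⟨c', h', hc'⟩ := exists_label h3
  obtain ⟨-, -, a3⟩ := inv_dichotomy h h' h1 h2
  rcases a3 with a3 | a3
  · exact krewerasAdj_of_split h hc h1 a3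
  · have := (krewerasAdj_of_split h' hc' h1 a3.1).symm
    rwa [← mul_assoc, swap_mul_self, one_mul] at this

/-- A lower index satisfies `i < w.symm i`, an upper one `w.symm i ≤ i`. Consequently the column
with its `1` in row `i` has no free entries. -/
theorem not_mem_invNC_of_mem_invNC (hw : w ∈ NC n) {i j k : Fin n} (hij : (i, j) ∈ invNC w) :
    (k, i) ∉ invNC w := by
  obtain ⟨c, h, hc⟩ := exists_label hw
  intro hk
  exact (invNC_cases h hk).2.1.not_gt (invNC_cases h hij).2.2.1

end Inversions

end QGr

/-! ### The fibre of `A` and the permutation `z_A` -/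

namespace QGr

open Equiv

theorem mem_initial {n r : ℕ} {x : Fin n} : x ∈ initial n r ↔ x.val < r := by
  simp [initial]

theorem mem_leftPart {n r : ℕ} {A : Finset (Fin n)} {x : Fin n} :
    x ∈ leftPart r A ↔ x.val < r ∧ x ∉ A := by
  simp [leftPart, mem_initial]

theorem mem_rightPart {n r : ℕ} {A : Finset (Fin n)} {x : Fin n} :
    x ∈ rightPart r A ↔ x ∈ A ∧ r ≤ x.val := by
  simp [rightPart, mem_initial]

theorem apply_mem_iff_of_act_eq {n r : ℕ} {A : Finset (Fin n)} {w : Perm (Fin n)}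
    (h : act r w = A) (x : Fin n) : w x ∈ A ↔ x.val < r := by
  rw [← h, act, Finset.mem_image]
  simp [mem_initial]

section Fiber

variable {n r : ℕ} {A : Finset (Fin n)} {α : Type*} {w : Perm (Fin n)} {c : Fin n → α}

/-- The preimage of `b` lies in `[r]`, below `b`, and a backwards cycle ascends only from its
minimum to its maximum. -/
theorem IsBack.rightPart_spec (h : IsBack w c) (hA : ∀ x, w x ∈ A ↔ x.val < r) {b : Fin n}
    (hb : b ∈ rightPart r A) : ∃ x, w x = b ∧ x.val < r ∧ c x = c b ∧
      ∀ t, c t = c b → x ≤ t ∧ t ≤ b := by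
  rw [mem_rightPart] at hb
  obtain ⟨x, rfl⟩ := w.surjective b
  have := h.step x
  have := h.label x
  have := hA x
  refine ⟨x, ?_⟩
  grind

/-- Here `w` descends across the cut at `r`, so `a` is the last point of its block before the cut. A
block thus has at most one such point. -/
theorem IsBack.leftPart_spec (h : IsBack w c) (hA : ∀ x, w x ∈ A ↔ x.val < r) {a : Fin n}
    (ha : a ∈ leftPart r A) : ∃ y, w y = a ∧ r ≤ y.val ∧ c y = c a ∧
      ∀ t, c t = c a → t < y → t ≤ a := by
  rw [mem_leftPart] at ha
  obtain ⟨y, rfl⟩ := w.surjective a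
  have := h.step y
  have := h.label y
  have := hA y
  refine ⟨y, ?_⟩
  grind

theorem IsBack.exists_rightPart (h : IsBack w c) (hA : ∀ x, w x ∈ A ↔ x.val < r) {a : Fin n}
    (ha : a ∈ leftPart r A) : ∃ b ∈ rightPart r A, c b = c a := by
  classical
  obtain ⟨y, hy⟩ := h.leftPart_spec hA ha
  rw [mem_leftPart] at ha
  obtain ⟨m, hm, hmin⟩ := (Finset.univ.filter (fun t => c t = c a)).exists_min_image id
    ⟨a, by simp⟩
  simp only [Finset.mem_filter, Finset.mem_univ, true_and, id] at hm hmin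
  refine ⟨w m, ?_, by rw [h.label, hm]⟩
  rw [mem_rightPart, hA]
  have := h.step m
  have := h.label m
  grind

theorem IsBack.exists_leftPart (h : IsBack w c) (hA : ∀ x, w x ∈ A ↔ x.val < r) {b : Fin n}
    (hb : b ∈ rightPart r A) : ∃ a ∈ leftPart r A, c a = c b := by
  classical
  obtain ⟨x, hx⟩ := h.rightPart_spec hA hb
  rw [mem_rightPart] at hb
  obtain ⟨a, ha, hmax⟩ := (Finset.univ.filter (fun t => c t = c b ∧ t.val < r)).exists_max_image id
    ⟨x, by simp [hx]⟩
  simp only [Finset.mem_filter, Finset.mem_univ, true_and, id] at ha hmax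
  refine ⟨a, ?_, ha.1⟩
  rw [mem_leftPart]
  refine ⟨ha.2, fun haA => ?_⟩
  obtain ⟨y, rfl⟩ := w.surjective a
  have := h.step y
  have := h.label y
  have := hmax y
  grind

theorem IsBack.leftPart_injOn (h : IsBack w c) (hA : ∀ x, w x ∈ A ↔ x.val < r) {a a' : Fin n}
    (ha : a ∈ leftPart r A) (ha' : a' ∈ leftPart r A) (haa : c a = c a') : a = a' := by
  obtain ⟨y, hy⟩ := h.leftPart_spec hA ha
  obtain ⟨y', hy'⟩ := h.leftPart_spec hA ha'
  rw [mem_leftPart] at ha ha'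
  have := hy.2.2.2 a'
  have := hy'.2.2.2 a
  grind

theorem IsBack.rightPart_injOn (h : IsBack w c) (hA : ∀ x, w x ∈ A ↔ x.val < r) {b b' : Fin n}
    (hb : b ∈ rightPart r A) (hb' : b' ∈ rightPart r A) (hbb : c b = c b') : b = b' := by
  obtain ⟨x, hx⟩ := h.rightPart_spec hA hb
  obtain ⟨x', hx'⟩ := h.rightPart_spec hA hb'
  exact le_antisymm (hx'.2.2.2 b hbb).2 (hx.2.2.2 b' hbb.symm).2

/-- Otherwise `a < a' < b < b'` would be a crossing. -/
theorem IsBack.match_anti (h : IsBack w c) (hc : Noncross c) (hA : ∀ x, w x ∈ A ↔ x.val < r)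
    {a a' b b' : Fin n} (ha : a ∈ leftPart r A) (ha' : a' ∈ leftPart r A)
    (hb : b ∈ rightPart r A) (hb' : b' ∈ rightPart r A) (hab : c a = c b) (hab' : c a' = c b') :
    a ≤ a' ↔ b' ≤ b := by
  have key : ∀ a a' b b' : Fin n, a ∈ leftPart r A → a' ∈ leftPart r A → b ∈ rightPart r A →
      b' ∈ rightPart r A → c a = c b → c a' = c b' → a < a' → b' < b := by
    intro a a' b b' ha ha' hb hb' hab hab' hlt
    by_contra! hle
    have h1 := h.leftPart_injOn hA ha ha'
    rw [mem_leftPart] at ha ha'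
    rw [mem_rightPart] at hb hb'
    have := hc a a' b b'
    grind
  constructor
  · intro hle
    rcases hle.eq_or_lt with rfl | hlt
    · exact (h.rightPart_injOn hA hb hb' (hab.symm.trans hab')).ge
    · exact (key _ _ _ _ ha ha' hb hb' hab hab' hlt).le
  · intro hle
    by_contra! hlt
    exact (key _ _ _ _ ha' ha hb' hb hab' hab hlt).not_ge hle

/-- The matching between `L` and `R` defining the blocks of `z_A` is realised by every element of
the fibre of `A`. -/
theorem IsBack.card_eq_card_iff (h : IsBack w c) (hc : Noncross c)
    (hA : ∀ x, w x ∈ A ↔ x.val < r) {a b : Fin n} (ha : a ∈ leftPart r A)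
    (hb : b ∈ rightPart r A) :
    ((leftPart r A).filter (a ≤ ·)).card = ((rightPart r A).filter (· ≤ b)).card ↔
      c a = c b := by
  have hg : ∀ a ∈ leftPart r A, ∃ b ∈ rightPart r A, c b = c a :=
    fun a ha => h.exists_rightPart hA ha
  choose! g hgR hgc using hg
  -- The order-reversing matching `g` carries the points of `L` from `a` upwards onto the points of
  -- `R` up to `g a`.
  have hcard : ((leftPart r A).filter (a ≤ ·)).card =
      ((rightPart r A).filter (· ≤ g a)).card := by
    refine Finset.card_bij (fun a' _ => g a') ?_ ?_ ?_
    · intro a' ha'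
      rw [Finset.mem_filter] at ha' ⊢
      exact ⟨hgR _ ha'.1, (h.match_anti hc hA ha ha'.1 (hgR _ ha) (hgR _ ha'.1) (hgc _ ha).symm
        (hgc _ ha'.1).symm).1 ha'.2⟩
    · intro a1 h1 a2 h2 h12
      rw [Finset.mem_filter] at h1 h2
      exact h.leftPart_injOn hA h1.1 h2.1 (by rw [← hgc _ h1.1, ← hgc _ h2.1, h12])
    · intro b' hb'
      rw [Finset.mem_filter] at hb'
      obtain ⟨a', ha', hab'⟩ := h.exists_leftPart hA hb'.1
      have e : g a' = b' := h.rightPart_injOn hA (hgR _ ha') hb'.1 ((hgc _ ha').trans hab')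
      refine ⟨a', Finset.mem_filter.2 ⟨ha', ?_⟩, e⟩
      exact (h.match_anti hc hA ha ha' (hgR _ ha) hb'.1 (hgc _ ha).symm hab').2 hb'.2
  rw [hcard]
  have hmono : ∀ b b' : Fin n, b' ∈ rightPart r A → b < b' →
      ((rightPart r A).filter (· ≤ b)).card < ((rightPart r A).filter (· ≤ b')).card := by
    intro b b' hb' hlt
    refine Finset.card_lt_card (Finset.ssubset_iff_of_subset ?_ |>.2 ⟨b', ?_, ?_⟩)
    · intro t ht
      rw [Finset.mem_filter] at ht ⊢
      exact ⟨ht.1, ht.2.trans hlt.le⟩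
    · simp [hb']
    · simp [hlt]
  constructor
  · intro heq
    rcases lt_trichotomy (g a) b with h1 | h1 | h1
    · exact absurd heq (hmono _ _ hb h1).ne
    · rw [← h1, hgc _ ha]
    · exact absurd heq (hmono _ _ (hgR _ ha) h1).ne'
  · intro heq
    rw [h.rightPart_injOn hA (hgR _ ha) hb ((hgc _ ha).trans heq)]

theorem mem_zBlock_iff (h : IsBack w c) (hc : Noncross c) (hA : ∀ x, w x ∈ A ↔ x.val < r)
    {b : Fin n} (hb : b ∈ rightPart r A) (x : Fin n) : x ∈ zBlock r A b ↔
      (x.val < r ∧ x ∉ A ∧ c x = c b) ∨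
      (r ≤ x.val ∧ x ≤ b ∧ ∀ b' ∈ rightPart r A, b' < b → b' < x) := by
  unfold zBlock
  rw [Finset.mem_union, Finset.mem_filter, Finset.mem_filter, mem_initial, not_lt]
  have : ∀ P : Prop, (x ∈ leftPart r A ∧ P) ↔ (x.val < r ∧ x ∉ A ∧ P) := fun P => by
    rw [mem_leftPart, and_assoc]
  rw [← this]
  refine or_congr (and_congr_right fun hx => h.card_eq_card_iff hc hA hx hb) (by simp)

theorem zBlock_disjoint (h : IsBack w c) (hc : Noncross c) (hA : ∀ x, w x ∈ A ↔ x.val < r)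
    {b b' x : Fin n} (hb : b ∈ rightPart r A) (hb' : b' ∈ rightPart r A)
    (hx : x ∈ zBlock r A b) (hx' : x ∈ zBlock r A b') : b = b' := by
  rw [mem_zBlock_iff h hc hA hb] at hx
  rw [mem_zBlock_iff h hc hA hb'] at hx'
  have := h.rightPart_injOn hA hb hb'
  grind

theorem prod_backCycle_apply_of_notMem {n : ℕ} {f : Fin n → Finset (Fin n)} {x : Fin n}
    (l : List (Fin n)) (hx : ∀ b ∈ l, x ∉ f b) :
    (l.map fun b => backCycle (f b)).prod x = x := by
  induction l with
  | nil => rfl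
  | cons b l ih =>
    rw [List.map_cons, List.prod_cons, Perm.mul_apply, ih fun b hb => hx b (by simp [hb])]
    exact backCycle_of_notMem (hx b (by simp))

theorem prod_backCycle_apply_of_mem {n : ℕ} {f : Fin n → Finset (Fin n)} {x b : Fin n}
    (l : List (Fin n)) (hl : l.Nodup) (hb : b ∈ l) (hx : x ∈ f b)
    (hd : ∀ b ∈ l, ∀ b' ∈ l, ∀ x, x ∈ f b → x ∈ f b' → b = b') :
    (l.map fun b => backCycle (f b)).prod x = backCycle (f b) x := by
  induction l with
  | nil => simp at hb
  | cons a l ih =>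
    rw [List.map_cons, List.prod_cons, Perm.mul_apply]
    rw [List.nodup_cons] at hl
    by_cases hab : a = b
    · subst hab
      rw [prod_backCycle_apply_of_notMem]
      intro b hb' hxb
      have := hd a (by simp) b (by simp [hb']) x hx hxb
      exact hl.1 (this ▸ hb')
    · have hbl : b ∈ l := by
        rcases List.mem_cons.1 hb with hb | hb
        · exact absurd hb.symm hab
        · exact hb
      rw [ih hl.2 hbl fun b hb b' hb' => hd b (by simp [hb]) b' (by simp [hb'])]
      apply backCycle_of_notMem
      intro hmem
      exact hab (hd a (by simp) b (by simp [hbl]) _ hmem (backCycle_mem hx))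

theorem zPerm_apply_of_mem (h : IsBack w c) (hc : Noncross c) (hA : ∀ x, w x ∈ A ↔ x.val < r)
    {b x : Fin n} (hb : b ∈ rightPart r A) (hx : x ∈ zBlock r A b) :
    zPerm r A x = backCycle (zBlock r A b) x := by
  refine prod_backCycle_apply_of_mem _ (Finset.sort_nodup _ _) ((Finset.mem_sort _).2 hb) hx ?_
  intro b hb b' hb' x hx hx'
  exact zBlock_disjoint h hc hA ((Finset.mem_sort _).1 hb) ((Finset.mem_sort _).1 hb') hx hx'

theorem zPerm_apply_of_notMem {x : Fin n} (hx : ∀ b ∈ rightPart r A, x ∉ zBlock r A b) :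
    zPerm r A x = x :=
  prod_backCycle_apply_of_notMem _ fun b hb => hx b ((Finset.mem_sort _).1 hb)

/-- The defining description of `z_A` as a union of backwards cycles. -/
theorem zPerm_spec (h : IsBack w c) (hc : Noncross c) (hA : ∀ x, w x ∈ A ↔ x.val < r)
    (x : Fin n) : ((∀ b ∈ rightPart r A, x ∉ zBlock r A b) ∧ zPerm r A x = x) ∨
      ∃ b ∈ rightPart r A, x ∈ zBlock r A b ∧ zPerm r A x ∈ zBlock r A b ∧
        ((zPerm r A x < x ∧ ∀ t ∈ zBlock r A b, t < x → t ≤ zPerm r A x) ∨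
          ∀ t ∈ zBlock r A b, x ≤ t ∧ t ≤ zPerm r A x) := by
  by_cases hx : ∀ b ∈ rightPart r A, x ∉ zBlock r A b
  · exact Or.inl ⟨hx, zPerm_apply_of_notMem hx⟩
  · right
    push Not at hx
    obtain ⟨b, hb, hxb⟩ := hx
    refine ⟨b, hb, hxb, ?_⟩
    rw [zPerm_apply_of_mem h hc hA hb hxb]
    exact ⟨backCycle_mem hxb, backCycle_step hxb⟩

/-- A block of `z_A` has only its minimum below `r`, and the minimum goes to the maximum. -/
theorem le_zPerm_apply (h : IsBack w c) (hc : Noncross c) (hA : ∀ x, w x ∈ A ↔ x.val < r)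
    {x : Fin n} (hx : x.val < r) : x ≤ zPerm r A x := by
  rcases zPerm_spec h hc hA x with ⟨-, e⟩ | ⟨b, hb, h1, h2, h3⟩
  · exact e.ge
  · rw [mem_zBlock_iff h hc hA hb] at h1 h2
    have := h.leftPart_injOn hA (a := x) (a' := zPerm r A x)
    rw [mem_leftPart, mem_leftPart] at this
    grind

theorem exists_mem_zBlock (h : IsBack w c) (hc : Noncross c) (hA : ∀ x, w x ∈ A ↔ x.val < r)
    {b : Fin n} (hb : b ∈ rightPart r A) : ∃ a ∈ zBlock r A b, a.val < r := by
  obtain ⟨a, ha, hab⟩ := h.exists_leftPart hA hb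
  rw [mem_leftPart] at ha
  exact ⟨a, (mem_zBlock_iff h hc hA hb a).2 (Or.inl ⟨ha.1, ha.2, hab⟩), ha.1⟩

theorem zPerm_apply_le (h : IsBack w c) (hc : Noncross c) (hA : ∀ x, w x ∈ A ↔ x.val < r)
    {x : Fin n} (hx : r ≤ x.val) : zPerm r A x ≤ x := by
  rcases zPerm_spec h hc hA x with ⟨-, e⟩ | ⟨b, hb, h1, h2, h3⟩
  · exact e.le
  · obtain ⟨a, ha, har⟩ := exists_mem_zBlock h hc hA hb
    grind

theorem exists_mem_zBlock_of_le {b x : Fin n} (h : IsBack w c) (hc : Noncross c)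
    (hA : ∀ x, w x ∈ A ↔ x.val < r) (hb : b ∈ rightPart r A) (hx : r ≤ x.val) (hxb : x ≤ b) :
    ∃ b' ∈ rightPart r A, x ∈ zBlock r A b' := by
  obtain ⟨b', hb', hmin⟩ := ((rightPart r A).filter (x ≤ ·)).exists_min_image id
    ⟨b, Finset.mem_filter.2 ⟨hb, hxb⟩⟩
  simp only [Finset.mem_filter, id] at hb' hmin
  refine ⟨b', hb'.1, (mem_zBlock_iff h hc hA hb'.1 x).2 (Or.inr ⟨hx, hb'.2, fun b'' h1 h2 => ?_⟩)⟩
  by_contra! hle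
  exact h2.not_ge (hmin b'' ⟨h1, hle⟩)

/-- Each block of `z_A` has a point below `r`, and together they cover everything from `r` up to the
maximum of `R`. A fixed point outside `[r]` therefore lies above all of `R`, as does everything
beyond it. -/
theorem zPerm_apply_eq_of_le (h : IsBack w c) (hc : Noncross c) (hA : ∀ x, w x ∈ A ↔ x.val < r)
    {x y : Fin n} (hx : r ≤ x.val) (hfix : zPerm r A x = x) (hxy : x ≤ y) :
    zPerm r A y = y := by
  have hall : ∀ b ∈ rightPart r A, b < x := by
    intro b hb
    by_contra! hle
    obtain ⟨b', hb', hxb'⟩ := exists_mem_zBlock_of_le h hc hA hb hx hle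
    obtain ⟨a, ha, har⟩ := exists_mem_zBlock h hc hA hb'
    rcases zPerm_spec h hc hA x with ⟨h1, -⟩ | ⟨b'', hb'', h1, h2, h3⟩
    · exact h1 b' hb' hxb'
    · have := zBlock_disjoint h hc hA hb' hb'' hxb' h1
      grind
  apply zPerm_apply_of_notMem
  intro b hb hmem
  rw [mem_zBlock_iff h hc hA hb] at hmem
  have := hall b hb
  grind

end Fiber

end QGr

/-! ### Noncrossing inversions in the fibre of `A` -/

namespace QGr

open Equiv

section Fiber

variable {n r : ℕ} {A : Finset (Fin n)} {α β : Type*} {w : Perm (Fin n)} {c : Fin n → α}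

theorem eq_of_mem_zBlock (h : IsBack w c) (hc : Noncross c) (hA : ∀ x, w x ∈ A ↔ x.val < r)
    {f : Fin n → β} (hf : ∀ x, f (zPerm r A x) = f x) {b x y : Fin n}
    (hb : b ∈ rightPart r A) (hx : x ∈ zBlock r A b) (hy : y ∈ zBlock r A b) : f x = f y := by
  obtain ⟨m, hm, hmin⟩ := (zBlock r A b).exists_min_image id ⟨x, hx⟩
  simp only [id] at hmin
  have key : ∀ x, x ∈ zBlock r A b → f x = f m := by
    intro x
    induction x using WellFoundedLT.induction with
    | _ x ih =>
      intro hx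
      rcases zPerm_spec h hc hA x with ⟨h1, -⟩ | ⟨b', hb', h1, h2, h3⟩
      · exact absurd hx (h1 b hb)
      · obtain rfl := zBlock_disjoint h hc hA hb hb' hx h1
        rcases h3 with ⟨h3, -⟩ | h3
        · rw [← hf x]; exact ih _ h3 h2
        · rw [le_antisymm (h3 m hm).1 (hmin x hx)]
  rw [key x hx, key y hy]

/-- Below `r` this is the matching. Otherwise a point `b` of `R` with `i ≤ b < j` would have a block
that also starts before `r` and crosses the block of `j`. -/
theorem mem_zBlock_of_label_eq (h : IsBack w c) (hc : Noncross c)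
    (hA : ∀ x, w x ∈ A ↔ x.val < r) {i j : Fin n} (hj : j ∈ rightPart r A) (hi : i ∉ A)
    (hij : c i = c j) : i ∈ zBlock r A j := by
  rw [mem_zBlock_iff h hc hA hj]
  by_cases hir : i.val < r
  · exact Or.inl ⟨hir, hi, hij⟩
  · obtain ⟨x, hx1, hx2, hx3, hx4⟩ := h.rightPart_spec hA hj
    refine Or.inr ⟨not_lt.1 hir, (hx4 i hij).2, fun b hb hbj => ?_⟩
    by_contra! hle
    obtain ⟨t, ht1, ht2, ht3, ht4⟩ := h.rightPart_spec hA hb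
    have hne := h.rightPart_injOn hA hb hj
    rw [mem_rightPart] at hb hj
    have e1 := hc x t i b
    have e2 := hc t x b j
    have e3 : i ≠ b := fun e => hi (e ▸ hb.1)
    have e4 := hx4 i hij
    grind

theorem mem_zBlock_self (h : IsBack w c) (hc : Noncross c) (hA : ∀ x, w x ∈ A ↔ x.val < r)
    {b : Fin n} (hb : b ∈ rightPart r A) : b ∈ zBlock r A b :=
  (mem_zBlock_iff h hc hA hb b).2 (Or.inr ⟨(mem_rightPart.1 hb).2, le_rfl, fun _ _ h => h⟩)

theorem symm_val_lt_iff (hA : ∀ x, w x ∈ A ↔ x.val < r) (i : Fin n) :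
    (w.symm i).val < r ↔ i ∈ A := by
  rw [← hA, apply_symm_apply]

/-- Noncrossing inversions of elements of the fibre of `A` that change `A` are noncrossing
inversions of `z_A`. -/
theorem mem_invNC_zPerm_of_mem_invNC (h : IsBack w c) (hc : Noncross c)
    (hA : ∀ x, w x ∈ A ↔ x.val < r) (hz : zPerm r A ∈ NC n)
    (hzA : ∀ x, zPerm r A x ∈ A ↔ x.val < r) {i j : Fin n} (hij : (i, j) ∈ invNC w)
    (hi : i ∉ A) (hj : j ∈ A) : (i, j) ∈ invNC (zPerm r A) := by
  obtain ⟨cz, hb, hbc⟩ := exists_label hz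
  obtain ⟨h1, h2, h3, h4⟩ := invNC_cases h hij
  have hxr := (symm_val_lt_iff hzA j).2 hj
  have hyr := mt (symm_val_lt_iff hzA i).1 hi
  have hwx := (symm_val_lt_iff hA j).2 hj
  have hwy := mt (symm_val_lt_iff hA i).1 hi
  rcases h4 with h4 | ⟨h4, h5, h6⟩
  · have hjR : j ∈ rightPart r A := by
      rw [mem_rightPart]
      refine ⟨hj, ?_⟩
      have s := h.step (w.symm i)
      have l := h.label (w.symm i)
      rw [apply_symm_apply] at s l
      grind
    have hmem := mem_zBlock_of_label_eq h hc hA hjR hi h4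
    exact mem_invNC_of_label_eq hb hbc h1
      (eq_of_mem_zBlock h hc hA hb.label hjR hmem (mem_zBlock_self h hc hA hjR)) (by omega)
  · have hiL : i ∈ leftPart r A := mem_leftPart.2 ⟨by omega, hi⟩
    apply mem_invNC_of_arc hb hbc h1
    · have := le_zPerm_apply h hc hA hxr
      rwa [apply_symm_apply] at this
    · by_cases hjr : j.val < r
      · omega
      · have hjR : j ∈ rightPart r A := mem_rightPart.2 ⟨hj, by omega⟩
        rcases zPerm_spec h hc hA ((zPerm r A).symm i) with ⟨-, e⟩ | ⟨b, hbR, m1, m2, -⟩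
        · rw [apply_symm_apply] at e
          omega
        · rw [apply_symm_apply] at m2
          rw [mem_zBlock_iff h hc hA hbR] at m1 m2
          have e1 : c i = c b := by
            rcases m2 with m2 | m2
            · exact m2.2.2
            · omega
          obtain ⟨x, -, -, -, hx⟩ := h.rightPart_spec hA hbR
          have e2 := (hx (w.symm i) (by rw [← h.label (w.symm i), apply_symm_apply, e1])).2
          rcases m1 with m1 | m1
          · omega
          · exact m1.2.2 j hjR (h5.trans_le e2)
    · intro s hs hsj
      have hsr : r ≤ s.val := by
        by_contra! hlt
        have := le_zPerm_apply h hc hA hlt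
        omega
      rcases zPerm_spec h hc hA s with ⟨-, e⟩ | ⟨b, hbR, m1, m2, -⟩
      · omega
      have hsA : zPerm r A s ∉ A := by rw [hzA]; omega
      rw [mem_zBlock_iff h hc hA hbR] at m1 m2
      have hL : zPerm r A s ∈ leftPart r A ∧ c (zPerm r A s) = c b := by
        rw [mem_leftPart]
        rcases m2 with m2 | m2
        · exact ⟨⟨m2.1, m2.2.1⟩, m2.2.2⟩
        · exfalso
          have hjR : j ∈ rightPart r A := mem_rightPart.2 ⟨hj, by omega⟩
          have := m2.2.2 j hjR (by rcases m1 with m1 | m1 <;> omega)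
          omega
      -- An arc of `z_A` over `j` ends in `L`. The arc of `w` with the same left end also passes
      -- over `j`, so `h6` applies to it.
      obtain ⟨y, hy1, hy2, hy3, hy4⟩ := h.leftPart_spec hA hL.1
      rw [← hy1]
      refine h6 y ?_ (hy1 ▸ hsj)
      by_cases hjr : j.val < r
      · omega
      have hjR : j ∈ rightPart r A := mem_rightPart.2 ⟨hj, by omega⟩
      have hjb : j < b := by rcases m1 with m1 | m1 <;> omega
      have hne := h.rightPart_injOn hA hjR hbR
      obtain ⟨x, hx1, hx2, hx3, hx4⟩ := h.rightPart_spec hA hjR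
      obtain ⟨x', -, -, -, hx'⟩ := h.rightPart_spec hA hbR
      by_contra! hle
      have e1 := hc x (zPerm r A s) j b
      have e2 := hc (zPerm r A s) x y j
      have e3 := (mem_leftPart.1 hL.1).1
      have e4 := hy4 x
      have e5 := hx4 y
      grind

theorem act_swap_mul (hA : act r w = A) {i j : Fin n} (hi : i ∉ A) (hj : j ∈ A) :
    act r (swap i j * w) = insert i (A.erase j) := by
  ext x
  have h2 : x ∈ act r (swap i j * w) ↔ swap i j x ∈ A := by
    have e1 := apply_mem_iff_of_act_eq (r := r) (w := swap i j * w) rfl (w.symm (swap i j x))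
    have e2 := apply_mem_iff_of_act_eq hA (w.symm (swap i j x))
    rw [Perm.mul_apply, apply_symm_apply, swap_apply_self] at e1
    rw [apply_symm_apply] at e2
    rw [e1, e2]
  rw [h2, swap_apply_def, Finset.mem_insert, Finset.mem_erase]
  grind

theorem invNC_zPerm_eq_invQ (hz : zPerm r A ∈ NCFiber r A) :
    invNC (zPerm r A) = invQ r A := by
  obtain ⟨hz, hzA⟩ := hz
  have hA := apply_mem_iff_of_act_eq hzA
  obtain ⟨c, h, hc⟩ := exists_label hz
  ext ⟨i, j⟩
  constructor
  · intro hij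
    obtain ⟨h1, h2, h3, h4⟩ := invNC_cases h hij
    -- If `j ∉ A`, then `z_A` fixes `j` and everything above it, which excludes both kinds of
    -- inversion.
    have hj : j ∈ A := by
      by_contra hj
      have hjr := not_lt.1 (mt (symm_val_lt_iff hA j).1 hj)
      have e := zPerm_apply_le h hc hA hjr
      rw [apply_symm_apply] at e
      have e2 := zPerm_apply_eq_of_le h hc hA hjr (by rw [apply_symm_apply]; omega) (y := j) h2
      have e3 : (zPerm r A).symm j = j := le_antisymm h2 e
      have l := h.step j
      rcases h4 with h4 | ⟨h4, h5, h6⟩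
      · grind
      · have e4 := zPerm_apply_eq_of_le h hc hA hjr (by rw [apply_symm_apply]; omega)
          (y := (zPerm r A).symm i) (by omega)
        rw [apply_symm_apply] at e4
        omega
    have hi : i ∉ A := by
      intro hi
      have e := le_zPerm_apply h hc hA ((symm_val_lt_iff hA i).2 hi)
      rw [apply_symm_apply] at e
      omega
    refine ⟨⟨h1, hj, hi⟩, ⟨i, j, hi, hj, rfl⟩, zPerm r A, swap i j * zPerm r A,
      krewerasAdj_of_mem_invNC hz hij, hzA.symm, (act_swap_mul hzA hi hj).symm⟩
  · rintro ⟨⟨h1, hj, hi⟩, -, w, u, hwu, hAw, hAu⟩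
    simp only at h1 hj hi hAu
    -- The witnesses differ by a transposition, and comparing their images of `[r]` forces it to be
    -- `(i j)`.
    obtain ⟨p, q, hpq, rfl⟩ := hwu.exists_swap
    have hwA := apply_mem_iff_of_act_eq hAw.symm
    have hu := hwu.symm.mem_NC
    have hne : act r (swap p q * w) ≠ A := by
      rw [← hAu]
      intro e
      exact hi (e ▸ Finset.mem_insert_self _ _)
    have hmem : ∀ x, swap p q x ∈ insert i (A.erase j) ↔ x ∈ A := by
      intro x
      rw [hAu]
      have := apply_mem_iff_of_act_eq (r := r) (w := swap p q * w) rfl (w.symm x)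
      rw [Perm.mul_apply, apply_symm_apply] at this
      rw [this, symm_val_lt_iff hwA]
    have hpi := hmem p
    have hqi := hmem q
    have hii := hmem i
    have hjj := hmem j
    simp only [swap_apply_def, Finset.mem_insert, Finset.mem_erase] at hpi hqi hii hjj
    obtain ⟨rfl, rfl⟩ : p = i ∧ q = j := by grind
    obtain ⟨c', h', hc'⟩ := exists_label hwu.mem_NC
    refine mem_invNC_zPerm_of_mem_invNC h' hc' hwA hz hA ⟨⟨h1, ?_⟩, hu⟩ hi hj
    have e1 := (symm_val_lt_iff hwA q).2 hj
    have e2 := mt (symm_val_lt_iff hwA p).1 hi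
    simp only
    omega

/-- An element of the fibre of `A` all of whose noncrossing inversions are inversions of `A`
equals `z_A`. -/
theorem eq_zPerm_of_invNC_subset (h : IsBack w c) (hc : Noncross c)
    (hA : ∀ x, w x ∈ A ↔ x.val < r) (hinv : ∀ i j, (i, j) ∈ invNC w → j ∈ A ∧ i ∉ A) :
    w = zPerm r A := by
  classical
  -- In a nontrivial block every point other than the maximum forms a noncrossing inversion with it.
  -- By hypothesis the maximum is then in `A` and the other points are not, so the block lies in the
  -- `z_A`-block of its maximum.
  have hblock : ∀ x y, c x = c y → x < y →
      ∃ b ∈ rightPart r A, x ∈ zBlock r A b ∧ y ∈ zBlock r A b ∧ c x = c b := by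
    intro x y hxy hlt
    obtain ⟨m, hm, hmin⟩ := (Finset.univ.filter (fun t => c t = c x)).exists_min_image id
      ⟨x, by simp⟩
    simp only [Finset.mem_filter, Finset.mem_univ, true_and, id] at hm hmin
    have hlm := h.label m
    have hsm : ∀ t, c t = c m → m ≤ t ∧ t ≤ w m := by
      have := h.step m
      grind
    have hothers : ∀ i, c i = c m → i ≠ w m → i ∉ A ∧ w m ∈ A := by
      intro i hi hne
      have hlt := lt_of_le_of_ne (hsm i hi).2 hne
      have := hinv i (w m) (mem_invNC_of_label_eq h hc hlt (by rw [hlm, hi]) ?_)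
      · exact ⟨this.2, this.1⟩
      · rw [symm_apply_apply]
        have l := h.label (w.symm i)
        rw [apply_symm_apply] at l
        refine lt_of_le_of_ne (hsm _ (l.symm.trans hi)).1 fun e => hne ?_
        rw [e, apply_symm_apply]
    have hR : w m ∈ rightPart r A := by
      have e1 := hothers x hm.symm (by have := hsm y; grind)
      rw [mem_rightPart]
      refine ⟨e1.2, ?_⟩
      have l := h.label (w.symm x)
      rw [apply_symm_apply] at l
      have e2 := mt (symm_val_lt_iff hA x).1 e1.1
      have e3 := hsm (w.symm x) (by grind)
      omega
    refine ⟨w m, hR, ?_, ?_, by rw [hlm, hm]⟩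
    · exact mem_zBlock_of_label_eq h hc hA hR
        (hothers x hm.symm (by have := hsm y; grind)).1 (by rw [hlm, hm])
    · by_cases hy : y = w m
      · rw [hy]; exact mem_zBlock_self h hc hA hR
      · exact mem_zBlock_of_label_eq h hc hA hR (hothers y (by grind) hy).1 (by grind)
  -- Conversely, a point `x` of the `z_A`-block outside the `w`-block of `b` would be fixed by `w`
  -- and lie under an arc of the latter. Attaching it to that arc is a noncrossing inversion, so `x
  -- ∈ A`, contradicting `w x = x` with `x` outside `[r]`.
  have hconst : ∀ b ∈ rightPart r A, ∀ x ∈ zBlock r A b, c x = c b := by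
    intro b hb x hx
    have hx' := (mem_zBlock_iff h hc hA hb x).1 hx
    rcases hx' with hx' | ⟨hxr, hxb, hxall⟩
    · exact hx'.2.2
    by_contra hne
    have hsing : ∀ t, c t = c x → t = x := by
      intro t ht
      by_contra htx
      rcases lt_or_gt_of_ne htx with hlt | hlt
      · obtain ⟨b', hb', m1, m2, m3⟩ := hblock t x ht hlt
        obtain rfl := zBlock_disjoint h hc hA hb hb' hx m2
        exact hne (ht.symm.trans m3)
      · obtain ⟨b', hb', m1, m2, m3⟩ := hblock x t ht.symm hlt
        obtain rfl := zBlock_disjoint h hc hA hb hb' hx m1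
        exact hne m3
    have hfix : w x = x := hsing _ (h.label x)
    have hfix' : w.symm x = x := by rw [symm_apply_eq, hfix]
    have hxlt : x < b := lt_of_le_of_ne hxb (fun e => hne (by rw [e]))
    obtain ⟨m, hm1, hm2, hm3, hm4⟩ := h.rightPart_spec hA hb
    obtain ⟨y, hy1, hy2, hy3, hy4⟩ := h.exists_arc (j := x) (p := m) (q := b) (by omega) hxlt hm3
      (fun e => hne (e.trans hm3))
    have ly := h.label y
    have sy := h.step y
    have hmem : (w y, x) ∈ invNC w := by
      refine mem_invNC_of_arc h hc hy2 hfix'.le (by rwa [symm_apply_apply]) ?_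
      intro s hs hsx
      by_contra! hlt
      have ls := h.label s
      have ss := h.step s
      by_cases hsy : c s = c y
      · grind
      · obtain ⟨b2, hb2, m1, m2, m3⟩ := hblock (w s) s ls (hsx.trans hs)
        have hyb : y ≤ b := (hm4 y (hy4.trans hm3)).2
        -- The block of `s` belongs to an element of `R` beyond `b`, so `s` lies beyond `b` and
        -- hence beyond `y`; the two arcs then cross.
        have hys : y < s := by
          refine hyb.trans_lt ?_
          rw [mem_zBlock_iff h hc hA hb2] at m2
          rcases m2 with m2 | m2
          · omega
          · refine m2.2.2 b hb ?_
            by_contra! hle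
            rcases hle.eq_or_lt with e | hlt2
            · exact hsy (by rw [← ls, m3, e, ← hm3, hy4])
            · have := hxall b2 hb2 hlt2
              omega
        exact hsy (by rw [← ls, ← ly]
                      exact (hc (w y) (w s) y s hlt (hsx.trans hy1) hys ly ls).symm)
    have := (symm_val_lt_iff hA x).2 (hinv _ _ hmem).1
    omega
  ext1 x
  rcases zPerm_spec h hc hA x with ⟨h1, h2⟩ | ⟨b, hb, h1, h2, h3⟩
  · rw [h2]
    by_contra hne
    have l := h.label x
    rcases lt_or_gt_of_ne hne with hlt | hlt
    · obtain ⟨b', hb', m1, m2, -⟩ := hblock _ _ l hlt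
      exact h1 b' hb' m2
    · obtain ⟨b', hb', m1, m2, -⟩ := hblock _ _ l.symm hlt
      exact h1 b' hb' m1
  · have hiff : ∀ t, t ∈ zBlock r A b ↔ c t = c x := by
      intro t
      constructor
      · intro ht
        rw [hconst b hb t ht, hconst b hb x h1]
      · intro ht
        rcases lt_trichotomy t x with hlt | rfl | hlt
        · obtain ⟨b', hb', m1, m2, -⟩ := hblock _ _ ht hlt
          obtain rfl := zBlock_disjoint h hc hA hb hb' h1 m2
          exact m1
        · exact h1
        · obtain ⟨b', hb', m1, m2, -⟩ := hblock _ _ ht.symm hlt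
          obtain rfl := zBlock_disjoint h hc hA hb hb' h1 m1
          exact m2
    have l := h.label x
    have s := h.step x
    simp only [hiff] at h2 h3
    grind

end Fiber

end QGr

/-! ### Matrices representing flags and subspaces -/

namespace QGr

open Equiv

/-- The flag spanned by the columns of an invertible matrix. -/
noncomputable def flagOfMatrix {n : ℕ} (N : Matrix (Fin n) (Fin n) ℂ)
    (hN : LinearIndependent ℂ N.col) : FlagVariety n where
  space i := Submodule.span ℂ (N.col '' {j | j.val < i.val})
  finrank_space i := by
    rw [Set.image_eq_range]
    have h := hN.comp (fun j : {j : Fin n | j.val < i.val} => j.1) Subtype.val_injective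
    refine (finrank_span_eq_card h).trans ?_
    exact Fintype.card_fin_lt_of_le (Nat.lt_succ_iff.1 i.2)
  mono _ _ hij := Submodule.span_mono (Set.image_mono fun _ hj =>
    lt_of_lt_of_le (show _ < _ from hj) (Fin.le_def.1 hij))

theorem repFlag_flagOfMatrix {n : ℕ} (N : Matrix (Fin n) (Fin n) ℂ)
    (hN : LinearIndependent ℂ N.col) : RepFlag N (flagOfMatrix N hN) := fun _ => rfl

section RepFlag

variable {n r : ℕ} {M : Matrix (Fin n) (Fin n) ℂ} {F G : FlagVariety n}

theorem RepFlag.eq (hF : RepFlag M F) (hG : RepFlag M G) : F = G := by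
  ext1
  funext i
  rw [hF i, hG i]

theorem RepFlag.finrank_span_range (h : RepFlag M F) :
    Module.finrank ℂ (Submodule.span ℂ (Set.range M.col)) = n := by
  have h1 := h (Fin.last n)
  have : {j : Fin n | j.val < (Fin.last n).val} = Set.univ := by
    ext j; simp
  rw [this, Set.image_univ] at h1
  rw [← h1, F.finrank_space]; rfl

theorem RepFlag.rank_eq (h : RepFlag M F) : M.rank = n := by
  rw [Matrix.rank_eq_finrank_span_cols, h.finrank_span_range]

theorem RepFlag.linearIndependent (h : RepFlag M F) : LinearIndependent ℂ M.col := by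
  rw [linearIndependent_iff_card_eq_finrank_span, Set.finrank, h.finrank_span_range,
    Fintype.card_fin]

theorem RepFlag.proj_eq (h : RepFlag M F) (hr : r ≤ n) :
    (proj hr F).1 = Submodule.span ℂ (M.col '' {j | j.val < r}) := h _

theorem RepFlag.proj_eq_range (h : RepFlag M F) (hr : r ≤ n) :
    (proj hr F).1 = Submodule.span ℂ (Set.range fun j : Fin r => M.col (Fin.castLE hr j)) := by
  rw [h.proj_eq hr]
  congr 1
  ext v
  constructor
  · rintro ⟨j, hj, rfl⟩
    exact ⟨⟨j, hj⟩, rfl⟩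
  · rintro ⟨j, rfl⟩
    exact ⟨Fin.castLE hr j, j.2, rfl⟩

theorem image_col_eq {A : Finset (Fin n)} {u : Perm (Fin n)} (hA : act r u = A)
    (f : Fin n → (Fin n → ℂ)) :
    f '' {j | j.val < r} = (fun a => f (u.symm a)) '' (A : Set (Fin n)) := by
  have h := apply_mem_iff_of_act_eq hA
  ext v
  constructor
  · rintro ⟨j, hj, rfl⟩
    exact ⟨u j, (h j).2 hj, by simp⟩
  · rintro ⟨a, ha, rfl⟩
    exact ⟨u.symm a, (symm_val_lt_iff h a).2 ha, rfl⟩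

/-- Rescaling the columns of a matrix does not change the flag. -/
theorem RepFlag.of_smul {N : Matrix (Fin n) (Fin n) ℂ} (h : RepFlag M F)
    (hN : ∀ j, ∃ d : ℂ, d ≠ 0 ∧ N.col j = d • M.col j) : RepFlag N F := by
  intro i
  rw [h i]
  choose d hd hN using hN
  apply le_antisymm
  · rw [Submodule.span_le]
    rintro _ ⟨j, hj, rfl⟩
    have : M.col j = (d j)⁻¹ • N.col j := by rw [hN, smul_smul, inv_mul_cancel₀ (hd j), one_smul]
    rw [this]
    exact Submodule.smul_mem _ _ (Submodule.subset_span ⟨j, hj, rfl⟩)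
  · rw [Submodule.span_le]
    rintro _ ⟨j, hj, rfl⟩
    rw [hN]
    exact Submodule.smul_mem _ _ (Submodule.subset_span ⟨j, hj, rfl⟩)

end RepFlag

/-! ### Echelon bases and Schubert cells -/

section Cells

variable {n r : ℕ} {A : Finset (Fin n)}

/-- Points of a cell in the Grassmannian in terms of spanning vectors indexed by `A`. -/
theorem mem_grCell_iff (hA : A.card = r) (S : Set (Fin n × Fin n)) (V : Gr r n) :
    V ∈ grCell A hA S ↔ ∃ v : Fin n → (Fin n → ℂ), (∀ a ∈ A, v a a = 1) ∧
      (∀ a ∈ A, ∀ i, i ≠ a → (i, a) ∉ S → v a i = 0) ∧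
      V.1 = Submodule.span ℂ (v '' (A : Set (Fin n))) := by
  have hmem : ∀ j, A.orderEmbOfFin hA j ∈ A := fun j => A.orderEmbOfFin_mem hA j
  have hsurj : ∀ a ∈ A, ∃ j, A.orderEmbOfFin hA j = a := by
    intro a ha
    have : a ∈ Set.range (A.orderEmbOfFin hA) := by rw [Finset.range_orderEmbOfFin]; exact ha
    exact this
  constructor
  · rintro ⟨M, h1, h2, h3⟩
    choose f hf using hsurj
    have hf' : ∀ j, f (A.orderEmbOfFin hA j) (hmem j) = j := fun j =>
      (A.orderEmbOfFin hA).injective (hf _ (hmem j))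
    refine ⟨fun a i => if h : a ∈ A then M i (f a h) else 0, ?_, ?_, ?_⟩
    · intro a ha
      have := h1 (f a ha)
      rw [hf a ha] at this
      simpa only [ha, dif_pos] using this
    · intro a ha i hi hS
      simpa only [ha, dif_pos] using h2 i (f a ha) (by rwa [hf a ha]) (by rwa [hf a ha])
    · rw [h3]
      congr 1
      ext x
      constructor
      · rintro ⟨j, rfl⟩
        refine ⟨_, hmem j, funext fun i => ?_⟩
        simp only [hmem j, dif_pos, hf', Matrix.col_apply]
      · rintro ⟨a, ha, rfl⟩
        have ha : a ∈ A := ha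
        refine ⟨f a ha, funext fun i => ?_⟩
        simp only [ha, dif_pos, Matrix.col_apply]
  · rintro ⟨v, h1, h2, h3⟩
    refine ⟨Matrix.of fun i j => v (A.orderEmbOfFin hA j) i, fun j => h1 _ (hmem j),
      fun i j hi hS => h2 _ (hmem j) i hi hS, ?_⟩
    rw [RepGr, h3]
    congr 1
    ext x
    constructor
    · rintro ⟨a, ha, rfl⟩
      obtain ⟨j, rfl⟩ := hsurj a ha
      exact ⟨j, rfl⟩
    · rintro ⟨j, rfl⟩
      exact ⟨_, hmem j, rfl⟩

/-- Reduced column echelon form. -/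
theorem exists_echelon {V : Submodule ℂ (Fin n → ℂ)} (hV : Module.finrank ℂ V = A.card)
    {v : Fin n → (Fin n → ℂ)} (hv : ∀ a ∈ A, v a ∈ V) (h1 : ∀ a ∈ A, v a a = 1)
    (h0 : ∀ a ∈ A, ∀ i, a < i → v a i = 0) :
    ∃ v' : Fin n → (Fin n → ℂ), (∀ a ∈ A, v' a a = 1) ∧
      (∀ a ∈ A, ∀ i, i ≠ a → (i, a) ∉ invSet A → v' a i = 0) ∧
      V = Submodule.span ℂ (v' '' (A : Set (Fin n))) := by
  classical
  have key : ∀ a, a ∈ A → ∃ x ∈ V, x a = 1 ∧ ∀ i, i ≠ a → (i, a) ∉ invSet A → x i = 0 := by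
    intro a
    induction a using WellFoundedLT.induction with
    | _ a ih =>
      intro ha
      choose! x hxV hx1 hx0 using ih
      -- Clear the entries of `v a` at smaller pivots; the vectors already reduced vanish at all
      -- pivots but their own.
      refine ⟨v a - ∑ b ∈ A.filter (· < a), v a b • x b, ?_, ?_, ?_⟩
      · refine V.sub_mem (hv a ha) (V.sum_mem fun b hb => V.smul_mem _ ?_)
        rw [Finset.mem_filter] at hb
        exact hxV b hb.2 hb.1
      · rw [Pi.sub_apply, Finset.sum_apply, Finset.sum_eq_zero, h1 a ha, sub_zero]
        intro b hb
        rw [Finset.mem_filter] at hb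
        rw [Pi.smul_apply, hx0 b hb.2 hb.1 a hb.2.ne' fun h => h.1.not_gt hb.2, smul_zero]
      · intro i hia hi
        rw [Pi.sub_apply, Finset.sum_apply]
        have hgt : ∀ b ∈ A.filter (· < a), b ≠ i → (i ∈ A ∨ a < i) → (v a b • x b) i = 0 := by
          intro b hb hbi hi'
          rw [Finset.mem_filter] at hb
          rw [Pi.smul_apply, hx0 b hb.2 hb.1 i hbi.symm ?_, smul_zero]
          rintro ⟨e1, -, e2⟩
          rcases hi' with hi' | hi'
          · exact e2 hi'
          · exact (e1.trans hb.2).not_gt hi'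
        rcases lt_or_gt_of_ne hia with hlt | hlt
        · have hiA : i ∈ A := by
            by_contra hiA
            exact hi ⟨hlt, ha, hiA⟩
          rw [Finset.sum_eq_single i (fun b hb hbi => hgt b hb hbi (Or.inl hiA)) (by simp [hiA, hlt]),
            Pi.smul_apply, hx1 i hlt hiA, smul_eq_mul, mul_one, sub_self]
        · rw [h0 a ha i hlt, Finset.sum_eq_zero, sub_zero]
          intro b hb
          refine hgt b hb ?_ (Or.inr hlt)
          rw [Finset.mem_filter] at hb
          exact (hb.2.trans hlt).ne
  choose! v' hv'V hv'1 hv'0 using key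
  refine ⟨v', hv'1, hv'0, ?_⟩
  have hle : Submodule.span ℂ (v' '' (A : Set (Fin n))) ≤ V := by
    rw [Submodule.span_le]
    rintro _ ⟨a, ha, rfl⟩
    exact hv'V a ha
  refine (Submodule.eq_of_le_of_finrank_eq hle ?_).symm
  rw [hV, Set.image_eq_range]
  have hli : LinearIndependent ℂ (fun a : (A : Set (Fin n)) => v' a) := by
    rw [Fintype.linearIndependent_iff]
    intro g hg a
    have := congrFun hg a.1
    rw [Finset.sum_apply, Finset.sum_eq_single a] at this
    · simpa [hv'1 a.1 a.2] using this
    · intro b _ hba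
      rw [Pi.smul_apply, hv'0 b.1 b.2 a.1 (fun e => hba (Subtype.ext e.symm)) fun h => h.2.2 a.2,
        smul_zero]
    · simp
  refine (finrank_span_eq_card hli).trans ?_
  simp

theorem mapsTo_schubertCell {u : Perm (Fin n)} (hr : r ≤ n) (hA : A.card = r)
    (hu : act r u = A) : Set.MapsTo (proj hr) (ncSchubertCell u) (schubertCell A hA) := by
  rintro F ⟨M, h1, h2, h3⟩
  rw [schubertCell, mem_grCell_iff]
  have hspan := h3.proj_eq hr
  rw [image_col_eq hu] at hspan
  refine exists_echelon (v := fun a => M.col (u.symm a)) (by rw [(proj hr F).2, hA]) ?_ ?_ ?_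
  · intro a ha
    rw [hspan]
    exact Submodule.subset_span ⟨a, ha, rfl⟩
  · intro a _
    have := h1 (u.symm a)
    rwa [apply_symm_apply] at this
  · intro a _ i hi
    refine h2 i (u.symm a) (by rw [apply_symm_apply]; exact hi.ne') ?_
    rw [apply_symm_apply]
    rintro ⟨h, -⟩
    exact h.1.not_gt hi

end Cells

end QGr

/-! ### The isomorphism of cells -/

namespace QGr

open Equiv

/-- The matrix of coordinate functions. -/
noncomputable def coordMatrix (n m : ℕ) : Matrix (Fin n) (Fin m) (MvPolynomial (Fin n × Fin m) ℂ) :=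
  Matrix.of fun i j => MvPolynomial.X (i, j)

theorem map_evalMat_eq {n m k l : ℕ} (M : Matrix (Fin n) (Fin m) ℂ)
    (P : Matrix (Fin k) (Fin l) (MvPolynomial (Fin n × Fin m) ℂ)) :
    P.map (evalMat M) = P.map (MvPolynomial.eval fun ij : Fin n × Fin m => M ij.1 ij.2) := rfl

theorem coordMatrix_map {n m : ℕ} (M : Matrix (Fin n) (Fin m) ℂ) :
    (coordMatrix n m).map (MvPolynomial.eval fun ij : Fin n × Fin m => M ij.1 ij.2) = M := by
  ext i j
  simp [coordMatrix]

theorem isRegularOn_proj {n r : ℕ} (hr : r ≤ n) (Y : Set (FlagVariety n)) :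
    IsRegularOn RepFlag RepGr (proj hr) Y := by
  have heval : ∀ M : Matrix (Fin n) (Fin n) ℂ,
      ((coordMatrix n n).submatrix id (Fin.castLE hr)).map (evalMat M) =
        M.submatrix id (Fin.castLE hr) := by
    intro M
    rw [map_evalMat_eq, ← Matrix.submatrix_map, coordMatrix_map]
  have hrep : ∀ M F, RepFlag M F → RepGr (M.submatrix id (Fin.castLE hr)) (proj hr F) :=
    fun M F h => h.proj_eq_range hr
  intro M F _ hM
  refine ⟨(coordMatrix n n).submatrix id (Fin.castLE hr), ?_, ?_⟩
  · rw [heval, Matrix.rank_eq_finrank_span_cols]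
    have h := hrep M F hM
    rw [RepGr] at h
    rw [← h]
    exact (proj hr F).2
  · intro M' F' _ hM' _
    rw [heval]
    exact hrep M' F' hM'

/-- The polynomial matrix inverting the projection on the cell of a permutation `u` with trivial
columns to the right of the `r`-th one. -/
noncomputable def liftMatrix {n r : ℕ} (hr : r ≤ n) (u : Perm (Fin n)) :
    Matrix (Fin n) (Fin n) (MvPolynomial (Fin n × Fin r) ℂ) :=
  Matrix.of fun i j => if h : j.val < r then
    (coordMatrix n r *
      ((coordMatrix n r).submatrix (fun k => u (Fin.castLE hr k)) id).adjugate) i ⟨j.val, h⟩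
    else if i = u j then 1 else 0

theorem liftMatrix_map {n r : ℕ} (hr : r ≤ n) (u : Perm (Fin n)) (M : Matrix (Fin n) (Fin r) ℂ)
    (i j : Fin n) : (liftMatrix hr u).map (evalMat M) i j = if h : j.val < r then
      (M * (M.submatrix (fun k => u (Fin.castLE hr k)) id).adjugate) i ⟨j.val, h⟩
      else if i = u j then 1 else 0 := by
  rw [map_evalMat_eq, Matrix.map_apply, liftMatrix, Matrix.of_apply]
  split_ifs with h1 h2
  · rw [← Matrix.map_apply (f := (MvPolynomial.eval fun ij : Fin n × Fin r => M ij.1 ij.2)),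
      Matrix.map_mul, coordMatrix_map, ← RingHom.mapMatrix_apply, RingHom.map_adjugate,
      RingHom.mapMatrix_apply, ← Matrix.submatrix_map, coordMatrix_map]
  · simp
  · simp

section Iso

variable {n r : ℕ} {A : Finset (Fin n)} {u : Perm (Fin n)}

/-- If two matrices span the same column space and the first one contains an identity matrix in
the rows `f`, then the rows `f` of the second one form an invertible matrix and
determine it. -/
theorem eq_mul_of_span_eq {N M : Matrix (Fin n) (Fin r) ℂ} {f : Fin r → Fin n}
    (hN : N.submatrix f id = 1)
    (h : Submodule.span ℂ (Set.range N.col) = Submodule.span ℂ (Set.range M.col)) :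
    M = N * M.submatrix f id ∧ (M.submatrix f id).det ≠ 0 := by
  have key : ∀ X Y : Matrix (Fin n) (Fin r) ℂ, Set.range Y.col ⊆
      (Submodule.span ℂ (Set.range X.col) : Set (Fin n → ℂ)) → ∃ G : Matrix (Fin r) (Fin r) ℂ, Y = X * G := by
    intro X Y hXY
    have : ∀ j, ∃ g : Fin r → ℂ, X.mulVec g = Y.col j := by
      intro j
      have hj := hXY ⟨j, rfl⟩
      rw [SetLike.mem_coe, ← Matrix.range_mulVecLin] at hj
      exact hj
    choose g hg using this
    refine ⟨Matrix.of fun i j => g j i, ?_⟩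
    ext i j
    exact (congrFun (hg j) i).symm
  obtain ⟨G, hG⟩ := key N M (h ▸ Submodule.subset_span)
  obtain ⟨H, hH⟩ := key M N (h.symm ▸ Submodule.subset_span)
  have e1 : M.submatrix f id = G := by
    rw [hG, ← Matrix.submatrix_mul_equiv N G f (Equiv.refl _) id, Equiv.coe_refl, hN, one_mul,
      Matrix.submatrix_id_id]
  have e2 : (1 : Matrix (Fin r) (Fin r) ℂ) = M.submatrix f id * H := by
    rw [← hN]
    conv_lhs => rw [hH]
    rw [← Matrix.submatrix_mul_equiv M H f (Equiv.refl _) id, Equiv.coe_refl,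
      Matrix.submatrix_id_id]
  refine ⟨by rw [e1]; exact hG, fun hdet => ?_⟩
  have := congrArg Matrix.det e2
  rw [Matrix.det_one, Matrix.det_mul, hdet, zero_mul] at this
  exact one_ne_zero this

/-- The matrix of `F` has an identity in the rows `u [r]` of its first `r` columns, so multiplying
`M` by the adjugate of its own such rows gives those columns times a nonzero determinant. The
adjugate keeps the formula polynomial, and scaling is harmless to the flag. -/
theorem repFlag_liftMatrix (hr : r ≤ n) (hu : act r u = A)
    (hinv : ∀ i j, (i, j) ∈ invNC u → j ∈ A ∧ i ∉ A) {F : FlagVariety n}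
    (hF : F ∈ ncSchubertCell u) {M : Matrix (Fin n) (Fin r) ℂ} (hM : RepGr M (proj hr F)) :
    RepFlag ((liftMatrix hr u).map (evalMat M)) F := by
  obtain ⟨N, h1, h0, hN⟩ := hF
  have hA := apply_mem_iff_of_act_eq hu
  have hone : (N.submatrix id (Fin.castLE hr)).submatrix (fun k => u (Fin.castLE hr k)) id = 1 := by
    ext i j
    rw [Matrix.submatrix_apply, Matrix.submatrix_apply, Matrix.one_apply]
    split_ifs with hij
    · rw [hij]; exact h1 _
    · refine h0 _ _ (fun e => hij ?_) fun h => (hinv _ _ h).2 ((hA _).2 i.2)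
      exact Fin.castLE_injective hr (u.injective e)
  have hspan : Submodule.span ℂ (Set.range (N.submatrix id (Fin.castLE hr)).col) =
      Submodule.span ℂ (Set.range M.col) := by
    rw [RepGr] at hM
    rw [← hM]
    exact (hN.proj_eq_range hr).symm
  obtain ⟨hMN, hdet⟩ := eq_mul_of_span_eq hone hspan
  refine hN.of_smul fun j => ?_
  by_cases hj : j.val < r
  · refine ⟨_, hdet, funext fun i => ?_⟩
    rw [Matrix.col_apply, liftMatrix_map, dif_pos hj, Pi.smul_apply, Matrix.col_apply]
    nth_rw 1 [hMN]
    rw [Matrix.mul_assoc, Matrix.mul_adjugate, Matrix.mul_smul, Matrix.mul_one,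
      Matrix.smul_apply]
    rfl
  · refine ⟨1, one_ne_zero, funext fun i => ?_⟩
    rw [Matrix.col_apply, liftMatrix_map, dif_neg hj, one_smul, Matrix.col_apply]
    split_ifs with hi
    · rw [hi, h1]
    · exact (h0 i j hi fun h => hj ((hA j).1 (hinv _ _ h).1)).symm

theorem exists_mem_ncSchubertCell (hr : r ≤ n) (hAr : A.card = r) (hu : act r u = A)
    (hinv : ∀ i j, (i, j) ∈ invNC u → j ∈ A ∧ i ∉ A) {V : Gr r n}
    (hV : V ∈ grCell A hAr (invNC u)) : ∃ F ∈ ncSchubertCell u, proj hr F = V := by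
  obtain ⟨v, h1, h0, hV⟩ := (mem_grCell_iff hAr _ V).1 hV
  have hA := apply_mem_iff_of_act_eq hu
  let N : Matrix (Fin n) (Fin n) ℂ :=
    Matrix.of fun i j => if j.val < r then v (u j) i else if i = u j then 1 else 0
  have hN : ∀ i j, N i j = if j.val < r then v (u j) i else if i = u j then 1 else 0 :=
    fun _ _ => rfl
  have hN1 : ∀ j, N (u j) j = 1 := by
    intro j
    rw [hN, if_pos (rfl : u j = u j)]
    split_ifs with hj
    · exact h1 _ ((hA j).2 hj)
    · rfl
  have hN0 : ∀ i j, i ≠ u j → (i, u j) ∉ invNC u → N i j = 0 := by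
    intro i j hi hij
    rw [hN]
    split_ifs with hj
    · exact h0 _ ((hA j).2 hj) i hi hij
    · rfl
  have hli : LinearIndependent ℂ N.col := by
    rw [Fintype.linearIndependent_iff]
    intro g hg
    have hrow : ∀ k, ∑ j, g j * N (u k) j = 0 := by
      intro k
      have := congrFun hg (u k)
      rwa [Finset.sum_apply] at this
    -- A row in `A` has its only nonzero entry at its pivot. Once these coefficients vanish, the
    -- remaining columns are distinct unit vectors.
    have hlow : ∀ k : Fin n, k.val < r → g k = 0 := by
      intro k hk
      have := hrow k
      rw [Finset.sum_eq_single k, hN1, mul_one] at this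
      · exact this
      · intro j _ hjk
        rw [hN0 _ _ (fun e => hjk (u.injective e).symm) fun h => (hinv _ _ h).2 ((hA k).2 hk),
          mul_zero]
      · simp
    intro k
    have := hrow k
    rw [Finset.sum_eq_single k, hN1, mul_one] at this
    · exact this
    · intro j _ hjk
      by_cases hj : j.val < r
      · rw [hlow j hj, zero_mul]
      · rw [hN0 _ _ (fun e => hjk (u.injective e).symm) fun h => hj ((hA j).1 (hinv _ _ h).1),
          mul_zero]
    · simp
  refine ⟨flagOfMatrix N hli, ⟨N, hN1, hN0, repFlag_flagOfMatrix N hli⟩, Subtype.ext ?_⟩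
  rw [(repFlag_flagOfMatrix N hli).proj_eq hr, image_col_eq hu, hV]
  congr 1
  refine Set.image_congr fun a ha => funext fun i => ?_
  rw [Matrix.col_apply, hN, if_pos ((symm_val_lt_iff hA a).2 ha), apply_symm_apply]

theorem proj_mem_grCell (hr : r ≤ n) (hAr : A.card = r) (hu : act r u = A) :
    Set.MapsTo (proj hr) (ncSchubertCell u) (grCell A hAr (invNC u)) := by
  rintro F ⟨M, h1, h0, hM⟩
  rw [mem_grCell_iff]
  refine ⟨fun a => M.col (u.symm a), fun a _ => ?_, fun a _ i hi hia => ?_, ?_⟩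
  · have := h1 (u.symm a)
    rwa [apply_symm_apply] at this
  · exact h0 i (u.symm a) (by rwa [apply_symm_apply]) (by rwa [apply_symm_apply])
  · rw [hM.proj_eq hr, image_col_eq hu]

theorem exists_repGr (V : Gr r n) : ∃ M : Matrix (Fin n) (Fin r) ℂ, RepGr M V := by
  let b := Module.finBasisOfFinrankEq ℂ V.1 V.2
  refine ⟨Matrix.of fun i j => (b j : Fin n → ℂ) i, ?_⟩
  have h := congrArg (Submodule.map V.1.subtype) b.span_eq
  rw [Submodule.map_span, ← Set.range_comp, Submodule.map_top, Submodule.range_subtype] at h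
  exact h.symm

/-- If all noncrossing inversions of `u` are inversions of `A`, then the projection is an
isomorphism from the noncrossing cell of `u` onto its image. -/
theorem isIsoOnto_of_invNC_subset (hr : r ≤ n) (hAr : A.card = r) (hu : act r u = A)
    (hinv : ∀ i j, (i, j) ∈ invNC u → j ∈ A ∧ i ∉ A) :
    IsIsoOnto RepFlag RepGr (proj hr) (ncSchubertCell u) (grCell A hAr (invNC u)) := by
  classical
  refine ⟨isRegularOn_proj hr _, proj_mem_grCell hr hAr hu, ?_⟩
  have hex : ∀ V ∈ grCell A hAr (invNC u), ∃ F ∈ ncSchubertCell u, proj hr F = V :=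
    fun V hV => exists_mem_ncSchubertCell hr hAr hu hinv hV
  -- A default value for `ψ` outside the cell.
  have : Nonempty (FlagVariety n) :=
    ⟨flagOfMatrix 1 (by
      rw [Matrix.linearIndependent_cols_iff_isUnit]
      exact isUnit_one)⟩
  choose! ψ hψ hψp using hex
  refine ⟨ψ, ?_, hψ, ?_, hψp⟩
  · intro M V hV hM
    have key : ∀ M V, V ∈ grCell A hAr (invNC u) → RepGr M V →
        RepFlag ((liftMatrix hr u).map (evalMat M)) (ψ V) := fun M V hV hM =>
      repFlag_liftMatrix hr hu hinv (hψ V hV) (by rwa [hψp V hV])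
    exact ⟨liftMatrix hr u, (key M V hV hM).rank_eq, fun M' V' hV' hM' _ => key M' V' hV' hM'⟩
  -- Both flags are represented by the same lifted matrix, hence agree.
  · intro F hF
    have hV := proj_mem_grCell hr hAr hu hF
    obtain ⟨M, hM⟩ := exists_repGr (proj hr F)
    exact (repFlag_liftMatrix hr hu hinv (hψ _ hV) (by rwa [hψp _ hV])).eq
      (repFlag_liftMatrix hr hu hinv hF hM)

end Iso

end QGr

/-! ### Fibres of positive dimension -/

namespace QGr

open Equiv

theorem isClosed_iff_isZariskiClosed {n : ℕ} {C : Set (FlagVariety n)} :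
    IsClosed C ↔ IsZariskiClosed RepFlag C := by
  rw [← isOpen_compl_iff]
  change Cᶜᶜ ∈ {C | IsZariskiClosed RepFlag C} ↔ _
  rw [compl_compl, Set.mem_ofPred_eq]

/-- The flags whose `i`-th space is contained in `W` form a closed set. -/
theorem isClosed_space_le {n : ℕ} (i : Fin (n + 1)) (W : Submodule ℂ (Fin n → ℂ)) :
    IsClosed {F : FlagVariety n | F.space i ≤ W} := by
  rw [isClosed_iff_isZariskiClosed]
  refine ⟨{p | ∃ f ∈ W.dualAnnihilator, ∃ j : Fin n, j.val < i.val ∧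
    p = ∑ k, MvPolynomial.C (f (Pi.single k 1)) * MvPolynomial.X (k, j)}, fun M F hM => ?_⟩
  have heval : ∀ (f : Module.Dual ℂ (Fin n → ℂ)) (j : Fin n),
      evalMat M (∑ k, MvPolynomial.C (f (Pi.single k 1)) * MvPolynomial.X (k, j)) =
        f (M.col j) := by
    intro f j
    have h := LinearMap.pi_apply_eq_sum_univ f (M.col j)
    rw [h, evalMat, map_sum]
    refine Finset.sum_congr rfl fun k _ => ?_
    rw [map_mul, MvPolynomial.eval_C, MvPolynomial.eval_X, smul_eq_mul, mul_comm, Matrix.col_apply]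
    congr 2
    ext l
    simp [Pi.single_apply, eq_comm]
  rw [Set.mem_ofPred_eq, hM i, Submodule.span_le]
  constructor
  · rintro h _ ⟨f, hf, j, hj, rfl⟩
    rw [heval]
    exact (Submodule.mem_dualAnnihilator f).1 hf _ (h ⟨j, hj, rfl⟩)
  · rintro h _ ⟨j, hj, rfl⟩
    rw [SetLike.mem_coe, ← Subspace.forall_mem_dualAnnihilator_apply_eq_zero_iff]
    intro f hf
    rw [← heval]
    exact h _ ⟨f, hf, j, hj, rfl⟩

/-- A space that contains a nonconstant "line" has positive dimension. -/
theorem topologicalKrullDim_pos_of_line {X : Type*} [TopologicalSpace X] (f : ℂ → X)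
    (hf : ∀ C : Set X, IsClosed C → f ⁻¹' C = Set.univ ∨ (f ⁻¹' C).Finite)
    {C : Set X} (hC : IsClosed C) (h0 : f 0 ∈ C) (h1 : f 1 ∉ C) :
    0 < topologicalKrullDim X := by
  -- Two closed sets covering the line cannot both have finite preimage, since `ℂ` is infinite.
  have hirr : IsIrreducible (Set.range f) := by
    refine ⟨Set.range_nonempty f, ?_⟩
    rw [isPreirreducible_iff_isClosed_union_isClosed]
    intro D E hD hE hDE
    rcases hf D hD with hD' | hD'
    · left
      rintro _ ⟨t, rfl⟩
      exact (hD' ▸ Set.mem_univ t : t ∈ f ⁻¹' D)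
    rcases hf E hE with hE' | hE'
    · right
      rintro _ ⟨t, rfl⟩
      exact (hE' ▸ Set.mem_univ t : t ∈ f ⁻¹' E)
    exact absurd ((hD'.union hE').subset fun t _ => hDE ⟨t, rfl⟩) (Set.infinite_univ (α := ℂ))
  let Z1 : TopologicalSpace.IrreducibleCloseds X :=
    ⟨closure (Set.range f), hirr.closure, isClosed_closure⟩
  let Z0 : TopologicalSpace.IrreducibleCloseds X :=
    ⟨closure {f 0}, isIrreducible_singleton.closure, isClosed_closure⟩
  refine Order.krullDim_pos_iff.2 ⟨Z0, Z1, lt_of_le_not_ge ?_ fun hle => ?_⟩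
  · change closure {f 0} ⊆ closure (Set.range f)
    exact closure_mono (by rintro _ rfl; exact ⟨0, rfl⟩)
  · have hle' : closure (Set.range f) ⊆ closure {f 0} := hle
    exact h1 (closure_minimal (Set.singleton_subset_iff.2 h0) hC
      (hle' (subset_closure ⟨1, rfl⟩)))

/-- A family of flags represented by matrices depending polynomially on a parameter meets every
closed set in a finite set, unless it is contained in it. -/
theorem preimage_eq_univ_or_finite {n : ℕ} {f : ℂ → FlagVariety n}
    (N : Matrix (Fin n) (Fin n) (Polynomial ℂ))
    (hN : ∀ t, RepFlag (N.map (Polynomial.eval t)) (f t)) {C : Set (FlagVariety n)}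
    (hC : IsClosed C) : f ⁻¹' C = Set.univ ∨ (f ⁻¹' C).Finite := by
  obtain ⟨S, hS⟩ := isClosed_iff_isZariskiClosed.1 hC
  have heval : ∀ (p : MvPolynomial (Fin n × Fin n) ℂ) t, evalMat (N.map (Polynomial.eval t)) p =
      (MvPolynomial.aeval (fun ij : Fin n × Fin n => N ij.1 ij.2) p).eval t := by
    intro p t
    rw [evalMat, ← MvPolynomial.coe_aeval_eq_eval, ← Polynomial.coe_aeval_eq_eval]
    change _ = ((Polynomial.aeval t).comp (MvPolynomial.aeval
      (fun ij : Fin n × Fin n => N ij.1 ij.2))) p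
    rw [MvPolynomial.comp_aeval]
    simp [Matrix.map_apply, Polynomial.coe_aeval_eq_eval]
  by_cases hall : ∀ p ∈ S, MvPolynomial.aeval (fun ij : Fin n × Fin n => N ij.1 ij.2) p = 0
  · left
    refine Set.eq_univ_of_forall fun t => (hS _ _ (hN t)).2 fun p hp => ?_
    rw [heval, hall p hp, Polynomial.eval_zero]
  · right
    push Not at hall
    obtain ⟨p, hp, hne⟩ := hall
    refine (Polynomial.finite_setOfPred_isRoot hne).subset fun t ht => ?_
    have := (hS _ _ (hN t)).1 ht p hp
    rwa [heval] at this

section Fiber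

variable {n r : ℕ} {A : Finset (Fin n)} {u : Perm (Fin n)}

/-- Let `c` and `d` be the columns with pivots `j` and `i`, so `c < d`. Column `d` is a unit vector,
so adding multiples of it to column `c` changes only the free entry `(i, c)`. The flag stays in the
cell and `V_r` is preserved, but the span of the columns up to `c` moves. -/
theorem topologicalKrullDim_fiber_pos (hr : r ≤ n) (hu : u ∈ NCFiber r A) {i j : Fin n}
    (hij : (i, j) ∈ invNC u) (hnot : ¬ (j ∈ A ∧ i ∉ A)) {V : Gr r n}
    (hV : V ∈ proj hr '' ncSchubertCell u) :
    0 < topologicalKrullDim {F : FlagVariety n // F ∈ ncSchubertCell u ∧ proj hr F = V} := by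
  obtain ⟨F, ⟨M, h1, h0, hM⟩, rfl⟩ := hV
  have hA := apply_mem_iff_of_act_eq hu.2
  obtain ⟨c, rfl⟩ := u.surjective j
  obtain ⟨d, rfl⟩ := u.surjective i
  have hcd : c < d := by
    have := hij.1.2
    simpa using this
  have hlt : u d < u c := hij.1.1
  have hcol : M.col d = Pi.single (u d) 1 := by
    funext k
    rw [Matrix.col_apply]
    by_cases hk : k = u d
    · rw [hk, h1, Pi.single_eq_same]
    · rw [Pi.single_eq_of_ne hk]
      exact h0 k d hk (not_mem_invNC_of_mem_invNC hu.1 hij)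
  let N : ℂ → Matrix (Fin n) (Fin n) ℂ := fun t =>
    M.updateCol c fun k => M k c + t • M k d
  have hNc : ∀ t, (N t).col c = M.col c + t • M.col d := by
    intro t
    funext k
    simp [N, Matrix.col_apply]
  have hNj : ∀ t k, k ≠ c → (N t).col k = M.col k := by
    intro t k hk
    funext l
    simp [N, Matrix.col_apply, Matrix.updateCol_ne hk]
  have hNli : ∀ t, LinearIndependent ℂ (N t).col := by
    intro t
    have hMli := hM.linearIndependent
    rw [Matrix.linearIndependent_cols_iff_isUnit, Matrix.isUnit_iff_isUnit_det] at hMli ⊢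
    rwa [Matrix.det_updateCol_add_smul_self M hcd.ne t]
  let f : ℂ → FlagVariety n := fun t => flagOfMatrix (N t) (hNli t)
  have hfN : ∀ t, RepFlag (N t) (f t) := fun t => repFlag_flagOfMatrix _ _
  have hcell : ∀ t, f t ∈ ncSchubertCell u := by
    intro t
    refine ⟨N t, fun k => ?_, fun l k hl hlk => ?_, hfN t⟩
    · by_cases hk : k = c
      · subst hk
        have := congrFun (hNc t) (u k)
        rw [Matrix.col_apply] at this
        rw [this, hcol, Pi.add_apply, Pi.smul_apply, Pi.single_eq_of_ne hlt.ne', smul_zero,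
          add_zero, Matrix.col_apply, h1]
      · have := congrFun (hNj t k hk) (u k)
        rw [Matrix.col_apply] at this
        rw [this, Matrix.col_apply, h1]
    · by_cases hk : k = c
      · subst hk
        have hld : l ≠ u d := by
          rintro rfl
          exact hlk hij
        have := congrFun (hNc t) l
        rw [Matrix.col_apply] at this
        rw [this, hcol, Pi.add_apply, Pi.smul_apply, Pi.single_eq_of_ne hld, smul_zero,
          add_zero, Matrix.col_apply, h0 l k hl hlk]
      · have := congrFun (hNj t k hk) l
        rw [Matrix.col_apply] at this
        rw [this, Matrix.col_apply, h0 l k hl hlk]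
  have hproj : ∀ t, proj hr (f t) = proj hr F := by
    intro t
    apply Subtype.ext
    refine Submodule.eq_of_le_of_finrank_eq ?_ ((proj hr (f t)).2.trans (proj hr F).2.symm)
    rw [(hfN t).proj_eq hr, hM.proj_eq hr, Submodule.span_le]
    rintro _ ⟨k, hk, rfl⟩
    by_cases hkc : k = c
    · subst hkc
      -- This is where `hnot` enters: it excludes `c < r ≤ d`.
      have hd : d.val < r := by
        rw [← hA]
        by_contra hd
        exact hnot ⟨(hA k).2 hk, hd⟩
      rw [SetLike.mem_coe, hNc]
      exact add_mem (Submodule.subset_span ⟨k, hk, rfl⟩)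
        (Submodule.smul_mem _ _ (Submodule.subset_span ⟨d, hd, rfl⟩))
    · rw [hNj t k hkc]
      exact Submodule.subset_span ⟨k, hk, rfl⟩
  let P : Matrix (Fin n) (Fin n) (Polynomial ℂ) :=
    (M.map Polynomial.C).updateCol c fun k => Polynomial.C (M k c) +
      Polynomial.X * Polynomial.C (M k d)
  have hP : ∀ t, P.map (Polynomial.eval t) = N t := by
    intro t
    ext k l
    by_cases hl : l = c
    · subst hl
      simp only [P, N, Matrix.map_apply, Matrix.updateCol_self, Polynomial.eval_add,
        Polynomial.eval_mul, Polynomial.eval_X, Polynomial.eval_C, smul_eq_mul]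
    · simp only [P, N, Matrix.map_apply, Matrix.updateCol_ne hl, Polynomial.eval_C]
  have hline : ∀ C : Set (FlagVariety n), IsClosed C → f ⁻¹' C = Set.univ ∨ (f ⁻¹' C).Finite :=
    fun C hC => preimage_eq_univ_or_finite P (fun t => by rw [hP]; exact hfN t) hC
  let g : ℂ → {F' : FlagVariety n // F' ∈ ncSchubertCell u ∧ proj hr F' = proj hr F} :=
    fun t => ⟨f t, hcell t, hproj t⟩
  -- The closed set that separates `g 0` from `g 1` requires the span of columns up to `c` to lie in
  -- that of `f 0`. At `1` this fails, because it would put column `d` in that span.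
  refine topologicalKrullDim_pos_of_line g ?_
    ((isClosed_space_le c.succ ((f 0).space c.succ)).preimage continuous_subtype_val) ?_ ?_
  · intro C hC
    obtain ⟨D, hD, rfl⟩ := isClosed_induced_iff.1 hC
    exact hline D hD
  · exact le_refl ((f 0).space c.succ)
  · intro hle
    have hle' : (f 1).space c.succ ≤ (f 0).space c.succ := hle
    rw [hfN 1 c.succ, hfN 0 c.succ] at hle'
    have hc : c ∈ {j : Fin n | j.val < c.succ.val} := by simp
    have e1 := hle' (Submodule.subset_span ⟨c, hc, rfl⟩)
    have e0 : (N 0).col c ∈ Submodule.span ℂ ((N 0).col '' {j | j.val < c.succ.val}) :=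
      Submodule.subset_span ⟨c, hc, rfl⟩
    have e2 := Submodule.sub_mem _ e1 e0
    rw [hNc, hNc, one_smul, zero_smul, add_zero, add_sub_cancel_left,
      ← hNj 0 d hcd.ne'] at e2
    refine (hNli 0).notMem_span_image (fun hd : d.val < c.succ.val => ?_) e2
    rw [Fin.val_succ] at hd
    omega

end Fiber

end QGr

/-! ### The theorem -/

theorem theorem5p3 (n r : ℕ) (hr : r ≤ n) (A : Finset (Fin n)) (hA : A.card = r)
    (u : Equiv.Perm (Fin n)) (hu : u ∈ QGr.NCFiber r A) :
    Set.MapsTo (QGr.proj hr) (QGr.ncSchubertCell u) (QGr.schubertCell A hA) ∧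
    (u = QGr.zPerm r A →
      QGr.IsIsoOnto QGr.RepFlag QGr.RepGr (QGr.proj hr)
        (QGr.ncSchubertCell u) (QGr.quasiSchubertCell A hA)) ∧
    (u ≠ QGr.zPerm r A →
      ∀ V ∈ QGr.proj hr '' QGr.ncSchubertCell u,
        0 < topologicalKrullDim
          {F : QGr.FlagVariety n // F ∈ QGr.ncSchubertCell u ∧ QGr.proj hr F = V}) := by
  refine ⟨QGr.mapsTo_schubertCell hr hA hu.2, ?_, ?_⟩
  · rintro rfl
    have hinv := QGr.invNC_zPerm_eq_invQ hu
    rw [QGr.quasiSchubertCell, ← hinv]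
    refine QGr.isIsoOnto_of_invNC_subset hr hA hu.2 fun i j hij => ?_
    rw [hinv] at hij
    exact ⟨hij.1.2.1, hij.1.2.2⟩
  · intro hne V hV
    obtain ⟨c, h, hc⟩ := QGr.exists_label hu.1
    by_contra hdim
    refine hne (QGr.eq_zPerm_of_invNC_subset h hc (QGr.apply_mem_iff_of_act_eq hu.2)
      fun i j hij => ?_)
    by_contra hnot
    exact hdim (QGr.topologicalKrullDim_fiber_pos hr hu hij hnot hV)
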